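/- Let $\vec M=(E,\mathcal O)$ be a finitary binary oriented matroid, i.e. $\mathcal O$ is a set of signed circuits that contains exactly two, opposite, signings of each circuit of a matroid $M$ on a (possibly infinite, of any cardinality) ground set $E$, where all circuits of $M$ are finite and $M$ is representable over $\mathbb F_2$, and where $\mathcal O$ satisfies the oriented circuit elimination axiom: for all $C_0,C_1\in\mathcal O$ with $C_1\neq\pm C_0$ and every $e\in C_0^+\cap C_1^-$ there is a $C\in\mathcal O$ with $C^+\subseteq (C_0^+\cup C_1^+)\setminus\{e\}$ and $C^-\subseteq (C_0^-\cup C_1^-)\setminus\{e\}$. A signed circuit is called directed if all its signs are equal. A signed cocircuit is a signing $D$ of a cocircuit of $M$ that is orthogonal to every $C\in\mathcal O$: if the underlying sets of $C$ and $D$ meet, then on their intersection $C$ and $D$ are neither equal nor opposite. Then the following are equivalent: 1. $E$ can be partitioned into (the underlying sets of) directed circuits of $\vec M$; 2. $\vec M$ is balanced, i.e. $|D^+|=|D^-|$ (equality of cardinals) for every signed cocircuit $D$ of $\vec M$. -/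

import Mathlib

universe u

/-- A signed set in `α`, i.e. a `±1`-valued function on a subset of `α`, given by the set `pos` of
elements of sign `1` and the set `neg` of elements of sign `-1`. -/
@[ext]
structure SignedSet (α : Type u) where
  pos : Set α
  neg : Set α
  disjoint : Disjoint pos neg

namespace SignedSet

variable {α : Type u}

/-- The underlying set (domain) of a signed set. -/
def support (X : SignedSet α) : Set α := X.pos ∪ X.neg

/-- The opposite signed set. -/
instance : Neg (SignedSet α) := ⟨fun X => ⟨X.neg, X.pos, X.disjoint.symm⟩⟩

/-- The restriction of a signed set to the elements of `S`. -/
def restrict (X : SignedSet α) (S : Set α) : SignedSet α :=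
  ⟨X.pos ∩ S, X.neg ∩ S, X.disjoint.mono Set.inter_subset_left Set.inter_subset_left⟩

/-- All signs are `1`. -/
def IsPositive (X : SignedSet α) : Prop := X.neg = ∅

/-- All signs are `-1`. -/
def IsNegative (X : SignedSet α) : Prop := X.pos = ∅

/-- A signed set is directed if it is positive or negative. -/
def IsDirected (X : SignedSet α) : Prop := X.IsPositive ∨ X.IsNegative

/-- There are as many elements of sign `1` as of sign `-1`, as cardinal numbers. -/
def IsBalanced (X : SignedSet α) : Prop := Cardinal.mk X.pos = Cardinal.mk X.neg

/-- Orthogonality: if the underlying sets meet, then on their intersection the two signed sets are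
neither equal nor opposite. -/
def Orthogonal (X Y : SignedSet α) : Prop :=
  (X.support ∩ Y.support).Nonempty →
    X.restrict (X.support ∩ Y.support) ≠ Y.restrict (X.support ∩ Y.support) ∧
    X.restrict (X.support ∩ Y.support) ≠ -(Y.restrict (X.support ∩ Y.support))

/-- `𝒪` is a signature of the family `ℱ` of sets: it consists of exactly two signings of each member
of `ℱ`, and these two are opposite. -/
def IsSignature (𝒪 : Set (SignedSet α)) (ℱ : Set (Set α)) : Prop :=
  (∀ X ∈ 𝒪, X.support ∈ ℱ) ∧
    ∀ F ∈ ℱ, ∃ X : SignedSet α, X.support = F ∧ X ≠ -X ∧ {Y ∈ 𝒪 | Y.support = F} = {X, -X}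

end SignedSet

/-- A finitary oriented matroid: a finitary matroid together with a signature of its set of circuits
that satisfies the oriented circuit elimination axiom. -/
structure FinitaryOrientedMatroid (α : Type u) where
  /-- the underlying matroid, with ground set `matroid.E` -/
  matroid : Matroid α
  finitary : matroid.Finitary
  /-- the signed circuits -/
  signedCircuits : Set (SignedSet α)
  isSignature : SignedSet.IsSignature signedCircuits {C | matroid.IsCircuit C}
  elimination : ∀ C₀ ∈ signedCircuits, ∀ C₁ ∈ signedCircuits, C₁ ≠ C₀ → C₁ ≠ -C₀ →
    ∀ e ∈ C₀.pos ∩ C₁.neg, ∃ C ∈ signedCircuits,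
      C.neg ⊆ (C₀.neg ∪ C₁.neg) \ {e} ∧ C.pos ⊆ (C₀.pos ∪ C₁.pos) \ {e}

namespace Matroid

variable {α : Type u}

/-- A matroid is binary if it is represented by a family of vectors of a vector space over the
two-element field. (Nothing is lost by taking the space in the universe of `α`, since only the span
of the family matters.) -/
def IsBinary (M : Matroid α) : Prop :=
  ∃ (V : Type u) (_ : AddCommGroup V) (_ : Module (ZMod 2) V) (v : α → V),
    ∀ I ⊆ M.E, (M.Indep I ↔ LinearIndepOn (ZMod 2) v I)

end Matroid

namespace FinitaryOrientedMatroid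

variable {α : Type u}

/-- An oriented matroid is binary if its underlying matroid is. -/
def IsBinary (M : FinitaryOrientedMatroid α) : Prop := M.matroid.IsBinary

/-- The signed cocircuits: the signings of the cocircuits that are orthogonal to every signed
circuit. -/
def signedCocircuits (M : FinitaryOrientedMatroid α) : Set (SignedSet α) :=
  {D | M.matroid.IsCocircuit D.support ∧ ∀ C ∈ M.signedCircuits, C.Orthogonal D}

/-- An oriented matroid is balanced if each of its signed cocircuits is. -/
def IsBalanced (M : FinitaryOrientedMatroid α) : Prop :=
  ∀ D ∈ M.signedCocircuits, D.IsBalanced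

/-- The ground set is partitioned by (the underlying sets of) directed circuits. -/
def HasDirectedCircuitPartition (M : FinitaryOrientedMatroid α) : Prop :=
  ∃ 𝒜 : Set (Set α), 𝒜.PairwiseDisjoint id ∧ ⋃₀ 𝒜 = M.matroid.E ∧
    ∀ A ∈ 𝒜, ∃ C ∈ M.signedCircuits, C.IsDirected ∧ C.support = A

end FinitaryOrientedMatroid

open Cardinal Set

/-! Everything rests on unimodularity: in a binary oriented matroid, signed circuits and signed
cocircuits, read as `{0, ±1}`-vectors, are orthogonal over ℤ and not only in the weak sense of
signs. A positive circuit is finite, so by orthogonality it meets every signed cocircuit in as many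
positive as negative elements; summing over a partition into directed circuits gives balancedness.

Integral orthogonality comes from `circ_subset_span_fund`: the fundamental circuit vectors of any
base span all circuit vectors. This is invariant under base exchange because each new fundamental
vector is, up to sign, an old one or a sum of two old ones; binarity enters in `add_mem_circ`, which
makes that sum a circuit vector. Hence a vector orthogonal to the fundamental circuits of one base
is orthogonal to all circuits (`exists_cocirc`). `RegularSystem` records what is needed from then
on.

For the converse, `painting` puts each element of a balanced system into a nonnegative circuit,
since the alternative is a cocircuit with entries of one sign only. Deleting that finite circuit
keeps the system balanced, which settles countable ground sets greedily. The greedy process may lose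
balance at limits, so for `|E| = κ` uncountable one inducts on `κ`: `E` is the union of an
increasing chain of sets smaller than `κ` such that each set `N` minus the union `P` of its
predecessors carries a balanced restriction. Two closure conditions ensure this. If `P` absorbs all
small minimum hitting sets, circuits meeting `P` can be rerouted outside `P` around any few
elements, and `E \ P` is balanced (`Balanced.restr_diff_of_hits`). If `N \ P` absorbs enough
disjoint continuations, circuits leaving it can be reflected into it, and it is balanced too
(`Balanced.restr_of_closed`). In both cases an unbalanced cocircuit vector of the restriction
yields, by extension or by `painting`, an unbalanced one of the larger system. -/

/-- The integer pairing of a finitely supported vector with an arbitrary vector. -/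
noncomputable def pairing {α : Type u} (g : α → ℤ) : (α →₀ ℤ) →ₗ[ℤ] ℤ :=
  Finsupp.linearCombination ℤ g

/-! ### Evaluation of the pairing and sign arithmetic -/

section Pairing

variable {α : Type u} {g g' : α → ℤ} {c : α →₀ ℤ}

lemma pairing_eq_sum (g : α → ℤ) (c : α →₀ ℤ) : pairing g c = ∑ x ∈ c.support, c x * g x := by
  simp [pairing, Finsupp.linearCombination_apply, Finsupp.sum]

lemma pairing_congr (h : ∀ x, c x ≠ 0 → g x = g' x) : pairing g c = pairing g' c := by
  rw [pairing_eq_sum, pairing_eq_sum]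
  exact Finset.sum_congr rfl fun x hx => by rw [h x (Finsupp.mem_support_iff.1 hx)]

lemma pairing_eq_zero (h : ∀ x, c x = 0 ∨ g x = 0) : pairing g c = 0 := by
  rw [pairing_eq_sum]
  exact Finset.sum_eq_zero fun x _ => mul_eq_zero.2 (h x)

lemma pairing_neg_left (g : α → ℤ) (c : α →₀ ℤ) : pairing (-g) c = -pairing g c := by
  simp [pairing_eq_sum]

lemma pairing_pos (h : ∀ x, 0 ≤ c x * g x) {e : α} (he : 0 < c e * g e) : 0 < pairing g c := by
  rw [pairing_eq_sum]
  refine Finset.sum_pos' (fun x _ => h x) ⟨e, ?_, he⟩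
  rw [Finsupp.mem_support_iff]
  rintro h0
  simp [h0] at he

lemma pairing_eq_single (b : α) (h : ∀ x, x ≠ b → c x = 0 ∨ g x = 0) :
    pairing g c = c b * g b := by
  rw [pairing_eq_sum]
  refine Finset.sum_eq_single b (fun x _ hx => mul_eq_zero.2 (h x hx)) fun hb => ?_
  rw [Finsupp.notMem_support_iff.1 hb, zero_mul]

lemma pairing_eq_pair {b f : α} (hbf : b ≠ f)
    (h : ∀ x, x ≠ b → x ≠ f → c x = 0 ∨ g x = 0) :
    pairing g c = c b * g b + c f * g f := by
  classical
  rw [pairing_eq_sum, Finset.sum_subset (Finset.subset_union_left (s₂ := {b, f}))]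
  · rw [← Finset.sum_subset (Finset.subset_union_right (s₂ := {b, f})), Finset.sum_pair hbf]
    intro x _ hx
    simp only [Finset.mem_insert, Finset.mem_singleton, not_or] at hx
    exact mul_eq_zero.2 (h x hx.1 hx.2)
  · intro x _ hx
    rw [Finsupp.notMem_support_iff.1 hx, zero_mul]

end Pairing

lemma pos_of_mul_signs {a b d : ℤ} (h : 0 < a * b) (h' : 0 < b * d) : 0 < a * d := by
  have h3 : 0 < (a * d) * (b * b) := by
    calc 0 < a * b * (b * d) := mul_pos h h'
      _ = _ := by ring
  exact pos_of_mul_pos_left h3 (mul_self_nonneg _)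

lemma nonneg_of_mul_signs {a b d : ℤ} (h : 0 < a * b) (h' : 0 ≤ b * d) : 0 ≤ a * d := by
  rcases h'.eq_or_lt with h0 | h0
  · have hb : b ≠ 0 := fun hb => by simp [hb] at h
    rcases mul_eq_zero.1 h0.symm with h1 | h1
    · exact absurd h1 hb
    · simp [h1]
  · exact (pos_of_mul_signs h h0).le

/-! ### Regular systems, their cocircuit vectors and restrictions -/

/-- A regular (unimodular) system: a matroid together with `{0, ±1}`-valued integral vectors
supported by its circuits, such that each base has a dual family of integral cocircuit vectors. -/
structure RegularSystem (α : Type u) where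
  /-- the underlying matroid -/
  M : Matroid α
  /-- the circuit vectors -/
  circ : Set (α →₀ ℤ)
  neg_mem : ∀ c ∈ circ, -c ∈ circ
  val : ∀ c ∈ circ, ∀ x, c x = 0 ∨ c x = 1 ∨ c x = -1
  isCircuit : ∀ c ∈ circ, M.IsCircuit {x | c x ≠ 0}
  exists_circ : ∀ C, M.IsCircuit C → ∃ c ∈ circ, {x | c x ≠ 0} = C
  exists_cocirc : ∀ B, M.IsBase B → ∀ b ∈ B, ∃ g : α → ℤ, g b = 1 ∧ (∀ x ∈ B, x ≠ b → g x = 0) ∧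
    (∀ x, x ∉ M.E → g x = 0) ∧ ∀ c ∈ circ, pairing g c = 0

namespace RegularSystem

variable {α : Type u}

/-- Cocircuit vectors, described by a base meeting the cocircuit in one element. -/
def IsCocirc (S : RegularSystem α) (g : α → ℤ) : Prop :=
  (∀ x, x ∉ S.M.E → g x = 0) ∧ (∀ c ∈ S.circ, pairing g c = 0) ∧
    ∃ B, S.M.IsBase B ∧ ∃ b ∈ B, (g b = 1 ∨ g b = -1) ∧ ∀ x ∈ B, x ≠ b → g x = 0

/-- Every cocircuit vector has as many positive as negative entries. -/
def Balanced (S : RegularSystem α) : Prop :=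
  ∀ g, S.IsCocirc g → #{x | 0 < g x} = #{x | g x < 0}

variable {S : RegularSystem α} {c : α →₀ ℤ} {g g' : α → ℤ} {X : Set α}

lemma mem_ground (hc : c ∈ S.circ) {x : α} (hx : c x ≠ 0) : x ∈ S.M.E :=
  (S.isCircuit c hc).subset_ground hx

lemma IsCocirc.neg (hg : S.IsCocirc g) : S.IsCocirc (-g) := by
  obtain ⟨h0, h1, B, hB, b, hb, hgb, hgB⟩ := hg
  refine ⟨fun x hx => by simp [h0 x hx], fun c hc => by rw [pairing_neg_left, h1 c hc, neg_zero],
    B, hB, b, hb, ?_, fun x hx hxb => by simp [hgB x hx hxb]⟩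
  simp only [Pi.neg_apply]
  omega

/-- The fundamental circuit vector of an element with respect to a base. -/
lemma exists_fund {B : Set α} (hB : S.M.IsBase B) {x : α} (hx : x ∈ S.M.E) (hxB : x ∉ B) :
    ∃ c ∈ S.circ, c x ≠ 0 ∧ ∀ y, c y ≠ 0 → y = x ∨ y ∈ B := by
  obtain ⟨c, hc, hcC⟩ := S.exists_circ _ (hB.fundCircuit_isCircuit hx hxB)
  refine ⟨c, hc, ?_, fun y hy => ?_⟩
  · have := S.M.mem_fundCircuit x B
    rwa [← hcC] at this
  · have := S.M.fundCircuit_subset_insert x B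
    rw [← hcC] at this
    exact this hy

/-- The fundamental circuit of `x` meets `B` in `b` and in elements where both vectors vanish, so
orthogonality to it determines the value at `x` from the value at `b`. -/
lemma eq_mul_of_base {B : Set α} (hB : S.M.IsBase B) {b : α} (hb : b ∈ B)
    (hg : ∀ c ∈ S.circ, pairing g c = 0) (hgb : g b = 1 ∨ g b = -1)
    (hgB : ∀ x ∈ B, x ≠ b → g x = 0)
    (hg' : ∀ c ∈ S.circ, pairing g' c = 0) (hgB' : ∀ x ∈ B, x ≠ b → g' x = 0)
    {x : α} (hx : x ∈ S.M.E) : g' x = g' b * g b * g x := by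
  by_cases hxB : x ∈ B
  · by_cases hxb : x = b
    · subst hxb
      rcases hgb with h | h <;> simp [h]
    · rw [hgB x hxB hxb, hgB' x hxB hxb, mul_zero]
  · obtain ⟨c, hc, hcx, hcB⟩ := exists_fund hB hx hxB
    have hbx : b ≠ x := fun h => hxB (h ▸ hb)
    have h1 := hg c hc
    have h2 := hg' c hc
    have key : ∀ h : α → ℤ, (∀ x ∈ B, x ≠ b → h x = 0) →
        ∀ y, y ≠ b → y ≠ x → c y = 0 ∨ h y = 0 := by
      intro h hh y hyb hyx
      by_cases hcy : c y = 0
      · exact Or.inl hcy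
      · exact Or.inr (hh y ((hcB y hcy).resolve_left hyx) hyb)
    rw [pairing_eq_pair hbx (key g hgB)] at h1
    rw [pairing_eq_pair hbx (key g' hgB')] at h2
    have hsq : g b * g b = 1 := by rcases hgb with h | h <;> simp [h]
    refine mul_left_cancel₀ hcx ?_
    linear_combination h2 - g' b * g b * h1 + c b * g' b * hsq

/-- Pairing with the fundamental circuit of `x` leaves only the entries at `b` and `x`, and the
circuit entries are 0 or `±1`. -/
lemma IsCocirc.val (hg : S.IsCocirc g) (x : α) : g x = 0 ∨ g x = 1 ∨ g x = -1 := by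
  obtain ⟨h0, h1, B, hB, b, hb, hgb, hgB⟩ := hg
  by_cases hx : x ∈ S.M.E
  swap
  · exact Or.inl (h0 x hx)
  by_cases hxB : x ∈ B
  · by_cases hxb : x = b
    · exact Or.inr (hxb ▸ hgb)
    · exact Or.inl (hgB x hxB hxb)
  obtain ⟨c, hc, hcx, hcB⟩ := exists_fund hB hx hxB
  have hbx : b ≠ x := fun h => hxB (h ▸ hb)
  have h2 := h1 c hc
  rw [pairing_eq_pair hbx] at h2
  · rcases S.val c hc x with h | h | h <;> rcases S.val c hc b with h' | h' | h' <;>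
      rcases hgb with h'' | h'' <;> simp only [h, h', h''] at h2 hcx <;> omega
  · intro y hyb hyx
    by_cases hcy : c y = 0
    · exact Or.inl hcy
    · exact Or.inr (hgB y ((hcB y hcy).resolve_left hyx) hyb)

/-- The restriction of a regular system to a subset of its ground set. -/
def restr (S : RegularSystem α) (X : Set α) (hX : X ⊆ S.M.E) : RegularSystem α where
  M := S.M.restrict X
  circ := {c ∈ S.circ | ∀ x, c x ≠ 0 → x ∈ X}
  neg_mem c hc := ⟨S.neg_mem c hc.1, fun x hx => hc.2 x (by simpa using hx)⟩
  val c hc := S.val c hc.1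
  isCircuit c hc := (S.M.restrict_isCircuit_iff hX).2 ⟨S.isCircuit c hc.1, hc.2⟩
  exists_circ C hC := by
    rw [S.M.restrict_isCircuit_iff hX] at hC
    obtain ⟨c, hc, rfl⟩ := S.exists_circ C hC.1
    exact ⟨c, ⟨hc, hC.2⟩, rfl⟩
  exists_cocirc B hB b hb := by
    classical
    rw [S.M.isBase_restrict_iff hX] at hB
    obtain ⟨B', hB', hBB'⟩ := hB.indep.exists_isBase_superset
    obtain ⟨g, hgb, hgB, -, hg⟩ := S.exists_cocirc B' hB' b (hBB' hb)
    refine ⟨fun x => if x ∈ X then g x else 0, by simp [hB.subset hb, hgb],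
      fun x hx hxb => by simp [hgB x (hBB' hx) hxb], fun x hx => if_neg hx, fun c hc => ?_⟩
    rw [← hg c hc.1]
    exact pairing_congr fun x hx => if_pos (hc.2 x hx)

lemma restr_ground (S : RegularSystem α) (h : S.M.E ⊆ S.M.E) : S.restr S.M.E h = S := by
  cases S with
  | mk M circ _ _ h1 _ _ =>
    simp only [restr, RegularSystem.mk.injEq, Matroid.restrict_ground_eq_self, true_and]
    ext c
    exact ⟨fun h => h.1, fun h => ⟨h, fun x hx => (h1 c h).subset_ground hx⟩⟩

/-- A vector orthogonal to all circuits whose support in `X` is contained in that of a cocircuit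
vector `g` of the restriction to `X` is a multiple of `g`. -/
lemma IsCocirc.eq_mul (hg : S.IsCocirc g) (hg' : ∀ c ∈ S.circ, pairing g' c = 0)
    (h : ∀ x ∈ S.M.E, g x = 0 → g' x = 0) : ∃ t : ℤ, ∀ x ∈ S.M.E, g' x = t * g x := by
  obtain ⟨h0, h1, B, hB, b, hb, hgb, hgB⟩ := hg
  exact ⟨g' b * g b, fun x hx => eq_mul_of_base hB hb h1 hgb hgB hg'
    (fun y hy hyb => h y (hB.subset_ground hy) (hgB y hy hyb)) hx⟩

/-- A base of the restriction extends to a base of the whole system. The dual vector of the larger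
base at `b` agrees on `X` with `g` up to sign, by `eq_mul_of_base`. -/
lemma IsCocirc.exists_extend {hX : X ⊆ S.M.E} (hg : (S.restr X hX).IsCocirc g) :
    ∃ g', S.IsCocirc g' ∧ ∀ x ∈ X, g' x = g x := by
  obtain ⟨h0, h1, B, hB, b, hb, hgb, hgB⟩ := hg
  have hB1 : S.M.IsBasis B X := (S.M.isBase_restrict_iff hX).1 hB
  obtain ⟨B', hB', hBB'⟩ := hB1.indep.exists_isBase_superset
  obtain ⟨g', hgb', hgB', hgE', hg'⟩ := S.exists_cocirc B' hB' b (hBB' hb)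
  have hco : S.IsCocirc g' := ⟨hgE', hg', B', hB', b, hBB' hb, Or.inl hgb', hgB'⟩
  have key : ∀ x ∈ X, g' x = g b * g x := fun x hx => by
    have := eq_mul_of_base hB hb h1 hgb hgB (fun c hc => hg' c hc.1)
      (fun y hy => hgB' y (hBB' hy)) (x := x) hx
    rw [this, hgb', one_mul]
  rcases hgb with h | h
  · exact ⟨g', hco, fun x hx => by rw [key x hx, h, one_mul]⟩
  · exact ⟨-g', hco.neg, fun x hx => by rw [Pi.neg_apply, key x hx, h]; ring⟩

/-! ### The circuit lattice, conformal circuits and the painting lemma -/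

lemma pairing_eq_zero_of_mem_span (hg : ∀ c ∈ S.circ, pairing g c = 0) {z : α →₀ ℤ}
    (hz : z ∈ Submodule.span ℤ S.circ) : pairing g z = 0 := by
  have : Submodule.span ℤ S.circ ≤ LinearMap.ker (pairing g) := Submodule.span_le.2 hg
  exact this hz

lemma mem_ground_of_mem_span {z : α →₀ ℤ} (hz : z ∈ Submodule.span ℤ S.circ) {x : α}
    (hx : z x ≠ 0) : x ∈ S.M.E := by
  by_contra hxE
  refine hx (Submodule.span_induction (p := fun z _ => z x = 0) ?_ ?_ ?_ ?_ hz)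
  · intro c hc
    by_contra h
    exact hxE (mem_ground hc h)
  · simp
  · intro a b _ _ ha hb
    simp [ha, hb]
  · intro t a _ ha
    simp [ha]

/-- If `e` were not spanned by the rest of the support of `z`, some cocircuit vector would be 1 at
`e` and 0 on that rest, and its pairing with `z` would be `z e ≠ 0`. -/
lemma exists_circ_subset {z : α →₀ ℤ} (hz : z ∈ Submodule.span ℤ S.circ) {e : α} (he : z e ≠ 0) :
    ∃ c ∈ S.circ, c e ≠ 0 ∧ ∀ x, c x ≠ 0 → z x ≠ 0 := by
  set Z : Set α := {x | z x ≠ 0} \ {e} with hZ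
  have hZE : Z ⊆ S.M.E := fun x hx => mem_ground_of_mem_span hz hx.1
  have heE := mem_ground_of_mem_span hz he
  have heZ : e ∉ Z := fun h => h.2 rfl
  by_cases hcl : e ∈ S.M.closure Z
  · obtain ⟨C, hCZ, hC, heC⟩ := Matroid.exists_isCircuit_of_mem_closure hcl heZ
    obtain ⟨c, hc, rfl⟩ := S.exists_circ C hC
    refine ⟨c, hc, heC, fun x hx => ?_⟩
    rcases hCZ hx with h | h
    · exact h ▸ he
    · exact h.1
  · exfalso
    obtain ⟨I, hI⟩ := S.M.exists_isBasis Z hZE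
    have hecl : e ∉ S.M.closure I := by rwa [hI.closure_eq_closure]
    have hIe : S.M.Indep (insert e I) := (hI.indep.notMem_closure_iff.1 hecl).1
    obtain ⟨B, hB, hIB⟩ := hIe.exists_isBase_superset
    obtain ⟨g, hge, hgB, -, hg⟩ := S.exists_cocirc B hB e (hIB (mem_insert _ _))
    have hgI : ∀ x ∈ I, g x = 0 := fun x hx =>
      hgB x (hIB (mem_insert_of_mem _ hx)) fun h => heZ (h ▸ hI.subset hx)
    have hgZ : ∀ x ∈ Z, g x = 0 := by
      intro x hx
      by_cases hxI : x ∈ I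
      · exact hgI x hxI
      obtain ⟨C, hCI, hC, hxC⟩ :=
        Matroid.exists_isCircuit_of_mem_closure (hI.subset_closure hx) hxI
      obtain ⟨c, hc, rfl⟩ := S.exists_circ C hC
      have := hg c hc
      rw [pairing_eq_single x] at this
      · exact (mul_eq_zero.1 this).resolve_left hxC
      · intro y hy
        by_cases hcy : c y = 0
        · exact Or.inl hcy
        · exact Or.inr (hgI y ((hCI hcy).resolve_left hy))
    have := pairing_eq_zero_of_mem_span hg hz
    rw [pairing_eq_single e, hge, mul_one] at this
    · exact he this
    · intro x hx
      by_cases hzx : z x = 0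
      · exact Or.inl hzx
      · exact Or.inr (hgZ x ⟨hzx, hx⟩)

/-- Conformal circuits: each nonzero entry of an element of the circuit lattice lies in a circuit
vector that is sign-compatible with it. -/
lemma exists_conformal {z : α →₀ ℤ} (hz : z ∈ Submodule.span ℤ S.circ) {e : α} (he : z e ≠ 0) :
    ∃ c ∈ S.circ, c e ≠ 0 ∧ ∀ x, c x ≠ 0 → 0 < c x * z x := by
  induction hn : z.support.card using Nat.strong_induction_on generalizing z with
  | _ n ih =>
  obtain ⟨c, hc, hce, hcz⟩ : ∃ c ∈ S.circ, 0 < c e * z e ∧ ∀ x, c x ≠ 0 → z x ≠ 0 := by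
    obtain ⟨c, hc, hce, hcz⟩ := exists_circ_subset hz he
    rcases lt_or_gt_of_ne (mul_ne_zero hce he) with h | h
    · exact ⟨-c, S.neg_mem c hc, by simpa using h, fun x hx => hcz x (by simpa using hx)⟩
    · exact ⟨c, hc, h, hcz⟩
  by_cases hbad : ∃ x, c x * z x < 0
  swap
  · push Not at hbad
    refine ⟨c, hc, fun h => by simp [h] at hce, fun x hx => ?_⟩
    exact lt_of_le_of_ne (hbad x) (mul_ne_zero hx (hcz x hx)).symm
  obtain ⟨x₀, hx₀, hmin⟩ : ∃ x₀, c x₀ * z x₀ < 0 ∧ ∀ y, c y * z y < 0 → |z x₀| ≤ |z y| := by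
    obtain ⟨x₀, hx₀, hmin⟩ := Finset.exists_min_image (z.support.filter fun x => c x * z x < 0)
      (fun x => |z x|) (by
        obtain ⟨x, hx⟩ := hbad
        refine ⟨x, Finset.mem_filter.2 ⟨Finsupp.mem_support_iff.2 fun h => ?_, hx⟩⟩
        simp [h] at hx)
    refine ⟨x₀, (Finset.mem_filter.1 hx₀).2, fun y hy => hmin y (Finset.mem_filter.2 ⟨?_, hy⟩)⟩
    exact Finsupp.mem_support_iff.2 fun h => by simp [h] at hy
  -- Adding `t` copies of `c` reduces `z` at the entries where the signs disagree. As `t` is the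
  -- least absolute value among these, no sign flips, the entry at `x₀` vanishes, and the entry at
  -- `e` grows. A circuit conformal to `w` is therefore conformal to `z`.
  set t : ℤ := |z x₀| with ht
  have ht0 : 0 < t := abs_pos.2 fun h => by simp [h] at hx₀
  set w : α →₀ ℤ := z + t • c with hw
  have hwx : ∀ x, w x = z x + t * c x := fun x => by simp [hw]
  have hwsign : ∀ x, 0 < w x * z x ∨ w x = 0 := by
    intro x
    rw [hwx]
    by_cases hz0 : z x = 0
    · right
      have : c x = 0 := by_contra fun h => hcz x h hz0
      rw [hz0, this, mul_zero, add_zero]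
    by_cases hneg : c x * z x < 0
    · have hle := hmin x hneg
      rcases S.val c hc x with h | h | h <;> rw [h] at hneg ⊢
      · simp at hneg
      · have : z x < 0 := by linarith
        rw [abs_of_neg this] at hle
        rcases eq_or_lt_of_le hle with h' | h'
        · right; linarith
        · left; exact mul_pos_of_neg_of_neg (by linarith) this
      · have : 0 < z x := by linarith
        rw [abs_of_pos this] at hle
        rcases eq_or_lt_of_le hle with h' | h'
        · right; linarith
        · left; exact mul_pos (by linarith) this
    · left
      have h2 : 0 < z x * z x := mul_self_pos.2 hz0
      have h3 : 0 ≤ t * (c x * z x) := mul_nonneg ht0.le (not_lt.1 hneg)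
      linarith [add_mul (z x) (t * c x) (z x), mul_assoc t (c x) (z x)]
  have hwz : ∀ x, w x ≠ 0 → z x ≠ 0 := fun x hx h => by
    have h' : c x = 0 := by_contra fun h' => hcz x h' h
    exact hx (by rw [hwx, h, h', mul_zero, add_zero])
  have hwx₀ : w x₀ = 0 := by
    rw [hwx, ht]
    rcases S.val c hc x₀ with h | h | h <;> rw [h] at hx₀ ⊢
    · simp at hx₀
    · rw [abs_of_neg (by linarith)]; ring
    · rw [abs_of_pos (by linarith)]; ring
  have hwe : w e ≠ 0 := by
    intro h
    have h2 : 0 < z e * z e := mul_self_pos.2 he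
    have h3 : 0 < t * (c e * z e) := mul_pos ht0 hce
    have h4 : w e * z e = 0 := by rw [h, zero_mul]
    rw [hwx] at h4
    linarith [add_mul (z e) (t * c e) (z e), mul_assoc t (c e) (z e)]
  obtain ⟨d, hd, hde, hdw⟩ := ih w.support.card (by
    rw [← hn]
    refine Finset.card_lt_card ⟨fun x hx => ?_, fun h => ?_⟩
    · exact Finsupp.mem_support_iff.2 (hwz x (Finsupp.mem_support_iff.1 hx))
    · have : x₀ ∈ w.support := h (Finsupp.mem_support_iff.2 fun h => by simp [h] at hx₀)
      exact Finsupp.mem_support_iff.1 this hwx₀)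
    (add_mem hz (Submodule.smul_mem _ _ (Submodule.subset_span hc))) hwe rfl
  refine ⟨d, hd, hde, fun x hx => ?_⟩
  have h1 := hdw x hx
  have h2 : 0 < w x * z x := (hwsign x).resolve_right fun h => by
    rw [show (z + t • c) x = 0 from h, mul_zero] at h1
    exact h1.false
  have h3 : 0 < (d x * z x) * (w x * w x) := by
    have := mul_pos h1 h2
    calc 0 < d x * w x * (w x * z x) := this
      _ = _ := by ring
  exact pos_of_mul_pos_left h3 (mul_self_nonneg _)

/-- A painting lemma: given signs `σ` and an element `e` with `σ e ≠ 0`, either `e` lies in a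
circuit that nowhere disagrees with `σ`, or `e` lies in a cocircuit that is supported in the
support of `σ` and agrees with `σ` there. -/
lemma painting (S : RegularSystem α) (σ : α → ℤ) {e : α} (heE : e ∈ S.M.E) (he : σ e ≠ 0) :
    (∃ c ∈ S.circ, c e ≠ 0 ∧ ∀ x, 0 ≤ c x * σ x) ∨
      ∃ g, S.IsCocirc g ∧ g e ≠ 0 ∧ ∀ x, g x = 0 ∨ 0 < g x * σ x := by
  by_contra! hcon
  obtain ⟨hcon1, hcon2⟩ := hcon
  -- `R` is the set of elements where the sign is ignored. A maximal `R` that is not bad exists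
  -- because circuits are finite; it will be the part of the ground set on which the desired
  -- cocircuit vanishes.
  set Bad : Set α → Prop := fun R => ∃ c ∈ S.circ, 0 < c e * σ e ∧ ∀ x, x ∉ R → 0 ≤ c x * σ x
    with hBad
  set Q : Set (Set α) := {R | {x | σ x = 0} ⊆ R ∧ R ⊆ {x | x ≠ e} ∧ ¬ Bad R} with hQ
  obtain ⟨R, hR0, hR⟩ : ∃ R, {x | σ x = 0} ⊆ R ∧ Maximal (· ∈ Q) R := by
    refine zorn_subset_nonempty Q ?_ _ ⟨subset_rfl, fun x hx h => he (h ▸ hx), ?_⟩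
    · intro 𝒞 h𝒞 hchain hne
      refine ⟨⋃₀ 𝒞, ⟨?_, sUnion_subset fun R hR => (h𝒞 hR).2.1, ?_⟩,
        fun R hR => subset_sUnion_of_mem hR⟩
      · obtain ⟨R, hR⟩ := hne
        exact (h𝒞 hR).1.trans (subset_sUnion_of_mem hR)
      · rintro ⟨c, hc, hce, hcR⟩
        have hfin : ({x | c x ≠ 0} ∩ ⋃₀ 𝒞).Finite :=
          (c.hasFiniteSupport.subset fun x hx => hx.1)
        obtain ⟨R, hR, hsub⟩ : ∃ R ∈ 𝒞, {x | c x ≠ 0} ∩ ⋃₀ 𝒞 ⊆ R :=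
          hchain.directedOn.exists_mem_subset_of_finite_of_subset_sUnion hne hfin
            inter_subset_right
        refine (h𝒞 hR).2.2 ⟨c, hc, hce, fun x hx => ?_⟩
        by_cases hcx : c x = 0
        · simp [hcx]
        · exact hcR x fun hxC => hx (hsub ⟨hcx, hxC⟩)
    · rintro ⟨c, hc, hce, hcR⟩
      obtain ⟨x, hx⟩ := hcon1 c hc (fun h => by simp [h] at hce)
      refine absurd hx (not_lt.2 ?_)
      by_cases h : σ x = 0
      · simp [h]
      · exact hcR x h
  obtain ⟨⟨-, hRe, hRbad⟩, hRmax⟩ := hR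
  have heR : e ∉ R := fun h => hRe h rfl
  have hnoz : ∀ z ∈ Submodule.span ℤ S.circ, 0 < z e * σ e →
      ¬ ∀ x, x ∉ R → 0 ≤ z x * σ x := by
    intro z hz hze hzR
    obtain ⟨c, hc, hce, hcz⟩ := exists_conformal hz (e := e) (fun h => by simp [h] at hze)
    refine hRbad ⟨c, hc, pos_of_mul_signs (hcz e hce) hze, fun x hx => ?_⟩
    by_cases hcx : c x = 0
    · simp [hcx]
    · exact nonneg_of_mul_signs (hcz x hcx) (hzR x hx)
  have hσ : ∀ x, x ∉ R → σ x ≠ 0 := fun x hx h => hx (hR0 h)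
  have hex : ∀ x, x ∉ R → x ≠ e → ∃ c ∈ S.circ, 0 < c e * σ e ∧ c x * σ x < 0 ∧
      ∀ y, y ∉ R → y ≠ x → 0 ≤ c y * σ y := by
    intro x hx hxe
    have hbad : Bad (insert x R) := by
      by_contra hbad
      exact hx (hRmax (y := insert x R) ⟨hR0.trans (subset_insert _ _),
        insert_subset hxe hRe, hbad⟩ (subset_insert _ _) (mem_insert _ _))
    obtain ⟨c, hc, hce, hcR⟩ := hbad
    have hcR' : ∀ y, y ∉ R → y ≠ x → 0 ≤ c y * σ y := fun y hy hyx =>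
      hcR y fun h => (mem_insert_iff.1 h).elim hyx hy
    refine ⟨c, hc, hce, ?_, hcR'⟩
    by_contra hcx
    refine hRbad ⟨c, hc, hce, fun y hy => ?_⟩
    by_cases hyx : y = x
    · exact hyx ▸ not_lt.1 hcx
    · exact hcR' y hy hyx
  -- Such a circuit `c`, whose only disagreement outside `R` is at `x`, also vanishes at every other
  -- `y ∉ R` different from `e`. Otherwise add the analogous circuit `c'` for `y`, so that the
  -- entries at `y` cancel. A circuit `d` conformal to `c + c'` and through `e` either avoids `x`,
  -- or takes the whole disagreement at `x` with it.
  have hex' : ∀ x, x ∉ R → x ≠ e → ∃ c ∈ S.circ, 0 < c e * σ e ∧ c x * σ x < 0 ∧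
      ∀ y, y ∉ R → y ≠ x → y ≠ e → c y = 0 := by
    intro x hx hxe
    obtain ⟨c, hc, hce, hcx, hcR⟩ := hex x hx hxe
    refine ⟨c, hc, hce, hcx, fun y hy hyx hye => by_contra fun hcy => ?_⟩
    obtain ⟨c', hc', hce', hcy', hcR'⟩ := hex y hy hye
    have hcy0 : 0 < c y * σ y := lt_of_le_of_ne (hcR y hy hyx) (mul_ne_zero hcy (hσ y hy)).symm
    have hz : c + c' ∈ Submodule.span ℤ S.circ :=
      add_mem (Submodule.subset_span hc) (Submodule.subset_span hc')
    have hzy : c y + c' y = 0 := by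
      rcases S.val c hc y with h | h | h <;> rcases S.val c' hc' y with h' | h' | h' <;>
        rw [h] at hcy0 ⊢ <;> rw [h'] at hcy' ⊢ <;> first | rfl | (exfalso; linarith)
    have hzR : ∀ w, w ∉ R → w ≠ x → 0 ≤ (c + c') w * σ w := by
      intro w hw hwx
      rw [Finsupp.add_apply]
      by_cases hwy : w = y
      · rw [hwy, hzy, zero_mul]
      · rw [add_mul]
        exact add_nonneg (hcR w hw hwx) (hcR' w hw hwy)
    have hze : 0 < (c + c') e * σ e := by
      rw [Finsupp.add_apply, add_mul]
      exact add_pos hce hce'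
    have hzx : (c + c') x * σ x < 0 := by
      by_contra h
      refine hnoz _ hz hze fun w hw => ?_
      by_cases hwx : w = x
      · exact hwx ▸ not_lt.1 h
      · exact hzR w hw hwx
    have hcx' : c' x = 0 := by
      have h1 := hcR' x hx (Ne.symm hyx)
      rw [Finsupp.add_apply] at hzx
      rcases S.val c hc x with h | h | h <;> rcases S.val c' hc' x with h' | h' | h' <;>
        rw [h] at hcx hzx <;> rw [h'] at h1 hzx ⊢ <;> exfalso <;> linarith
    obtain ⟨d, hd, hde, hdz⟩ := exists_conformal hz (e := e) (fun h => by simp [h] at hze)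
    have hdR : ∀ w, w ∉ R → w ≠ x → 0 ≤ d w * σ w := by
      intro w hw hwx
      by_cases hdw : d w = 0
      · simp [hdw]
      · exact nonneg_of_mul_signs (hdz w hdw) (hzR w hw hwx)
    have hdσ := pos_of_mul_signs (hdz e hde) hze
    by_cases hdx : d x = 0
    · refine hnoz d (Submodule.subset_span hd) hdσ fun w hw => ?_
      by_cases hwx : w = x
      · simp [hwx, hdx]
      · exact hdR w hw hwx
    -- Here `c + c'` has entry `±2` at `e`, so subtracting `d` leaves the sign there intact; at `x`
    -- the difference is 0, and elsewhere subtracting a conformal `{0, ±1}`-vector reverses no sign.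
    · refine hnoz (c + c' - d) (sub_mem hz (Submodule.subset_span hd)) ?_ fun w hw => ?_
      · rw [Finsupp.sub_apply, Finsupp.add_apply]
        rcases S.val c hc e with h | h | h <;> rcases S.val c' hc' e with h' | h' | h' <;>
          rcases S.val d hd e with h'' | h'' | h'' <;>
          rw [h] at hce ⊢ <;> rw [h'] at hce' ⊢ <;> rw [h''] at hdσ ⊢ <;> linarith
      · have hdw := hdz w
        by_cases hwx : w = x
        · subst hwx
          specialize hdw hdx
          rw [Finsupp.sub_apply]
          rw [Finsupp.add_apply, hcx', add_zero] at hdw ⊢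
          rcases S.val c hc w with h | h | h <;> rcases S.val d hd w with h' | h' | h' <;>
            rw [h] at hdw ⊢ <;> rw [h'] at hdw ⊢ <;> simp at hdw ⊢
        · have h1 := hzR w hw hwx
          rw [Finsupp.sub_apply]
          generalize (c + c') w = a at h1 hdw ⊢
          rcases S.val d hd w with h' | h' | h'
          · rwa [h', sub_zero]
          · have : 0 < a := by simpa [h'] using hdw
            have h2 : 0 ≤ σ w := nonneg_of_mul_nonneg_right h1 this
            rw [h']
            exact mul_nonneg (by omega) h2
          · have : a < 0 := by simpa [h'] using hdw
            have h2 : σ w ≤ 0 := by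
              by_contra h3
              linarith [mul_neg_of_neg_of_pos this (not_le.1 h3)]
            rw [h']
            exact mul_nonneg_of_nonpos_of_nonpos (by omega) h2
  -- A circuit inside `R` together with `e` would, with a suitable sign, show that `R` is bad.
  have hecl : e ∉ S.M.closure (R ∩ S.M.E) := by
    intro hcl
    obtain ⟨C, hCR, hC, heC⟩ :=
      Matroid.exists_isCircuit_of_mem_closure hcl fun h => heR h.1
    obtain ⟨c, hc, rfl⟩ := S.exists_circ C hC
    have h0 : ∀ x, x ∉ R → x ≠ e → c x = 0 := fun x hx hxe => by_contra fun h =>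
      (hCR h).elim hxe fun h => hx h.1
    rcases lt_or_gt_of_ne (mul_ne_zero heC he) with h | h
    · refine hRbad ⟨-c, S.neg_mem c hc, by simpa using h, fun x hx => ?_⟩
      by_cases hxe : x = e
      · subst hxe; simpa using h.le
      · simp [h0 x hx hxe]
    · refine hRbad ⟨c, hc, h, fun x hx => ?_⟩
      by_cases hxe : x = e
      · exact hxe ▸ h.le
      · simp [h0 x hx hxe]
  obtain ⟨I, hI⟩ := S.M.exists_isBasis (R ∩ S.M.E) inter_subset_right
  have heI : e ∉ S.M.closure I := by rwa [hI.closure_eq_closure]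
  have hIe : S.M.Indep (insert e I) := (hI.indep.notMem_closure_iff.1 heI).1
  obtain ⟨B, hB, hIB⟩ := hIe.exists_isBase_superset
  obtain ⟨g, hge, hgB, hgE, hg⟩ := S.exists_cocirc B hB e (hIB (mem_insert _ _))
  have hgI : ∀ x ∈ I, g x = 0 := fun x hx =>
    hgB x (hIB (mem_insert_of_mem _ hx)) fun h => heR (h ▸ (hI.subset hx).1)
  have hgR : ∀ x ∈ R, g x = 0 := by
    intro x hx
    by_cases hxE : x ∈ S.M.E
    swap
    · exact hgE x hxE
    by_cases hxI : x ∈ I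
    · exact hgI x hxI
    obtain ⟨C, hCI, hC, hxC⟩ :=
      Matroid.exists_isCircuit_of_mem_closure (hI.subset_closure ⟨hx, hxE⟩) hxI
    obtain ⟨c, hc, rfl⟩ := S.exists_circ C hC
    have := hg c hc
    rw [pairing_eq_single x] at this
    · exact (mul_eq_zero.1 this).resolve_left hxC
    · intro y hy
      by_cases hcy : c y = 0
      · exact Or.inl hcy
      · exact Or.inr (hgI y ((hCI hcy).resolve_left hy))
  have hco : S.IsCocirc g := ⟨hgE, hg, B, hB, e, hIB (mem_insert _ _), Or.inl hge, hgB⟩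
  -- The circuit given by `hex'` meets the support of `g` at most in `e` and `x`, agreeing with `σ`
  -- at `e` and disagreeing at `x`. Orthogonality thus forces `g` to have the same relation to `σ`
  -- at both elements.
  have hsign : ∀ x, g x = 0 ∨ 0 < g x * σ x * σ e := by
    intro x
    by_cases hxR : x ∈ R
    · exact Or.inl (hgR x hxR)
    right
    by_cases hxe : x = e
    · rw [hxe, hge, one_mul]
      exact mul_self_pos.2 he
    obtain ⟨c, hc, hce, hcx, hcR⟩ := hex' x hxR hxe
    have := hg c hc
    rw [pairing_eq_pair (Ne.symm hxe), hge, mul_one] at this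
    · have h1 : c e = - (c x * g x) := by linarith
      rw [h1] at hce
      have h2 : 0 < (c x * g x * σ e) * (c x * σ x) := mul_pos_of_neg_of_neg (by linarith) hcx
      have h3 : 0 < (g x * σ x * σ e) * (c x * c x) := by linarith
      exact pos_of_mul_pos_left h3 (mul_self_nonneg _)
    · intro y hye hyx
      by_cases hyR : y ∈ R
      · exact Or.inr (hgR y hyR)
      · exact Or.inl (hcR y hyR hyx hye)
  rcases lt_or_gt_of_ne he with h | h
  · obtain ⟨x, hx, hx'⟩ := hcon2 (-g) hco.neg (by simp [hge])
    rcases hsign x with h' | h'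
    · simp [h'] at hx
    · have := neg_of_mul_pos_left h' h.le
      simp only [Pi.neg_apply, neg_mul] at hx'
      linarith
  · obtain ⟨x, hx, hx'⟩ := hcon2 g hco (by simp [hge])
    rcases hsign x with h' | h'
    · exact hx h'
    · exact absurd (pos_of_mul_pos_left h' h.le) (not_lt.2 hx')

end RegularSystem

/-! ### Balancedness of restrictions -/

/-- A `{0, 1}`-valued vector orthogonal to a `{0, ±1}`-valued one meets as many positive as negative
entries of the latter. -/
lemma mk_pos_eq_mk_neg_of_pairing {α : Type u} {c : α →₀ ℤ} {g : α → ℤ}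
    (hc : ∀ x, c x = 0 ∨ c x = 1) (hg : ∀ x, g x = 0 ∨ g x = 1 ∨ g x = -1)
    (h : pairing g c = 0) :
    #({x | c x ≠ 0} ∩ {x | 0 < g x} : Set α) = #({x | c x ≠ 0} ∩ {x | g x < 0} : Set α) := by
  classical
  have h1 : ∑ x ∈ c.support, ((if 0 < g x then 1 else 0) - (if g x < 0 then 1 else 0) : ℤ) = 0 := by
    rw [pairing_eq_sum] at h
    refine (Finset.sum_congr rfl fun x hx => ?_).trans h
    rw [(hc x).resolve_left (Finsupp.mem_support_iff.1 hx)]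
    rcases hg x with h' | h' | h' <;> simp [h']
  rw [Finset.sum_sub_distrib, Finset.sum_boole, Finset.sum_boole, sub_eq_zero] at h1
  have e1 : ({x | c x ≠ 0} ∩ {x | 0 < g x} : Set α) = ↑(c.support.filter fun x => 0 < g x) := by
    ext; simp
  have e2 : ({x | c x ≠ 0} ∩ {x | g x < 0} : Set α) = ↑(c.support.filter fun x => g x < 0) := by
    ext; simp
  rw [e1, e2]
  refine (mk_coe_finset (s := c.support.filter fun x => 0 < g x)).trans
    (Eq.trans ?_ (mk_coe_finset (s := c.support.filter fun x => g x < 0)).symm)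
  exact_mod_cast h1

lemma mul_neg_iff_of_pos {t a : ℤ} (ht : 0 < t) : t * a < 0 ↔ a < 0 := by
  rw [← neg_pos, ← mul_neg, mul_pos_iff_of_pos_left ht, neg_pos]

namespace RegularSystem

variable {α : Type u} {S : RegularSystem α} {c : α →₀ ℤ} {g g' : α → ℤ} {X : Set α}

/-- The reverse inequality is the same statement for `-g`. -/
lemma balanced_of_not_lt (h : ∀ g, S.IsCocirc g → ¬ #{x | 0 < g x} < #{x | g x < 0}) :
    S.Balanced := by
  intro g hg
  refine le_antisymm (not_lt.1 ?_) (not_lt.1 (h g hg))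
  simpa using h (-g) hg.neg

/-- Removing a nonnegative circuit preserves balancedness. -/
lemma Balanced.restr_diff_circ (hS : S.Balanced) (hc : c ∈ S.circ) (hc0 : ∀ x, 0 ≤ c x) :
    (S.restr (S.M.E \ {x | c x ≠ 0}) sdiff_subset).Balanced := by
  intro g hg
  obtain ⟨g', hg', hgg'⟩ := hg.exists_extend
  have hc1 : ∀ x, c x = 0 ∨ c x = 1 := fun x => by
    have := S.val c hc x
    have := hc0 x
    omega
  have key := mk_pos_eq_mk_neg_of_pairing hc1 hg'.val (hg'.2.1 c hc)
  have hfin : ({x | c x ≠ 0} ∩ {x | 0 < g' x} : Set α).Finite :=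
    c.hasFiniteSupport.subset inter_subset_left
  have hval : ∀ x, (c x ≠ 0 → g x = 0) ∧ (c x = 0 → g x = g' x) := fun x => by
    refine ⟨fun h => hg.1 x fun hx => hx.2 h, fun h => ?_⟩
    by_cases hx : x ∈ S.M.E
    · exact (hgg' x ⟨hx, fun h' => h' h⟩).symm
    · rw [hg'.1 x hx, hg.1 x fun hx' => hx hx'.1]
  have e1 : {x | 0 < g' x} = {x | 0 < g x} ∪ ({x | c x ≠ 0} ∩ {x | 0 < g' x}) := by
    ext x
    by_cases h : c x = 0
    · simp [h, (hval x).2 h]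
    · simp [h, (hval x).1 h]
  have e2 : {x | g' x < 0} = {x | g x < 0} ∪ ({x | c x ≠ 0} ∩ {x | g' x < 0}) := by
    ext x
    by_cases h : c x = 0
    · simp [h, (hval x).2 h]
    · simp [h, (hval x).1 h]
  have d1 : Disjoint {x | 0 < g x} ({x | c x ≠ 0} ∩ {x | 0 < g' x}) :=
    disjoint_left.2 fun x hx hx' => by simp [(hval x).1 hx'.1] at hx
  have d2 : Disjoint {x | g x < 0} ({x | c x ≠ 0} ∩ {x | g' x < 0}) :=
    disjoint_left.2 fun x hx hx' => by simp [(hval x).1 hx'.1] at hx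
  have := hS g' hg'
  rw [e1, e2, mk_union_of_disjoint d1, mk_union_of_disjoint d2, ← key] at this
  -- The equal summands may be cancelled because the deleted circuit is finite.
  exact Cardinal.eq_of_add_eq_add_right this (lt_aleph0_iff_set_finite.2 hfin)

/-- In a balanced system each element lies in a nonnegative circuit. -/
lemma Balanced.exists_nonneg_circ (hS : S.Balanced) {e : α} (he : e ∈ S.M.E) :
    ∃ c ∈ S.circ, c e ≠ 0 ∧ ∀ x, 0 ≤ c x := by
  rcases S.painting (fun _ => 1) he one_ne_zero with ⟨c, hc, hce, h⟩ | ⟨g, hg, hge, h⟩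
  · exact ⟨c, hc, hce, by simpa using h⟩
  · have := hS g hg
    have e0 : {x | g x < 0} = ∅ := by
      ext x
      have := h x
      simp only [mul_one] at this
      simp only [mem_ofPred_eq, mem_empty_iff_false, iff_false]
      omega
    rw [e0, mk_eq_zero (∅ : Set α), mk_set_eq_zero_iff] at this
    have h1 := (h e).resolve_left hge
    rw [mul_one] at h1
    exact absurd (show e ∈ {x | 0 < g x} from h1) (by rw [this]; exact notMem_empty e)

/-- Balancedness passes to the complement of a set `N` of size at most `θ`, provided that circuits
meeting `N` can be rerouted outside `N` to avoid any given set of size at most `θ`. -/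
lemma Balanced.restr_diff (hS : S.Balanced) {N : Set α} {θ : Cardinal.{u}} (hθ : ℵ₀ ≤ θ)
    (hN : #N ≤ θ)
    (hrich : ∀ c ∈ S.circ, (∃ x ∈ N, c x ≠ 0) → ∀ U : Set α, #U ≤ θ →
      ∃ c' ∈ S.circ, (∀ x ∈ N, c' x = c x) ∧ ∀ x ∈ U, x ∉ N → c' x = 0) :
    (S.restr (S.M.E \ N) sdiff_subset).Balanced := by
  refine balanced_of_not_lt fun g hg hlt => ?_
  obtain ⟨g', hg', hgg'⟩ := hg.exists_extend
  have hgN : ∀ x ∈ N, g x = 0 := fun x hx => hg.1 x fun h => h.2 hx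
  have hgE : ∀ x, x ∉ S.M.E → g x = 0 := fun x hx => hg.1 x fun h => hx h.1
  -- With more than `θ` negative entries, the at most `θ` elements of `N` cannot repair the
  -- imbalance in the extension `g'`. Otherwise the support of `g` has size at most `θ` and can
  -- serve as the set `U` to be avoided.
  by_cases hbig : θ < #{x | g x < 0}
  · have h1 : #{x | 0 < g' x} < #{x | g x < 0} := by
      refine lt_of_le_of_lt (mk_le_mk_of_subset (t := {x | 0 < g x} ∪ N) fun x hx => ?_)
        ((mk_union_le _ _).trans_lt
          (add_lt_of_lt (hθ.trans hbig.le) hlt (hN.trans_lt hbig)))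
      by_cases hxN : x ∈ N
      · exact Or.inr hxN
      · left
        have hxE : x ∈ S.M.E := by
          by_contra h
          simp [hg'.1 x h] at hx
        have := hgg' x ⟨hxE, hxN⟩
        rw [mem_ofPred_eq] at hx ⊢
        omega
    have h2 : #{x | g x < 0} ≤ #{x | g' x < 0} := by
      refine mk_le_mk_of_subset fun x hx => ?_
      rw [mem_ofPred_eq] at hx ⊢
      have hxN : x ∉ N := fun h => by simp [hgN x h] at hx
      have hxE : x ∈ S.M.E := by_contra fun h => by simp [hgE x h] at hx
      rwa [hgg' x ⟨hxE, hxN⟩]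
    exact (h1.trans_le h2).ne (hS g' hg')
  · rw [not_lt] at hbig
    have hU : #({x | 0 < g x} ∪ {x | g x < 0} : Set α) ≤ θ :=
      (mk_union_le _ _).trans ((add_le_add (hlt.le.trans hbig) hbig).trans (add_eq_self hθ).le)
    -- Rerouting shows that `g` itself, extended by 0, is orthogonal to all circuits: `c - c'`
    -- vanishes on `N`, where alone `g` and `g'` can differ within the ground set, and `c'` misses
    -- the support of `g`.
    have horth : ∀ c ∈ S.circ, pairing g c = 0 := by
      intro c hc
      by_cases hcN : ∃ x ∈ N, c x ≠ 0
      · obtain ⟨c', hc', hcc', hc'U⟩ := hrich c hc hcN _ hU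
        have h1 : pairing g c' = 0 := by
          refine pairing_eq_zero fun x => ?_
          by_cases hxN : x ∈ N
          · exact Or.inr (hgN x hxN)
          by_cases hgx : g x = 0
          · exact Or.inr hgx
          · exact Or.inl (hc'U x ((lt_or_gt_of_ne hgx).symm) hxN)
        have h2 : pairing g' (c - c') = 0 := by
          rw [map_sub, hg'.2.1 c hc, hg'.2.1 c' hc', sub_zero]
        have h3 : pairing g (c - c') = pairing g' (c - c') := by
          refine pairing_congr fun x hx => ?_
          rw [Finsupp.sub_apply] at hx
          have hxN : x ∉ N := fun h => hx (by rw [hcc' x h, sub_self])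
          have hxE : x ∈ S.M.E := by
            by_contra h
            refine hx ?_
            rw [by_contra fun h' => h (mem_ground hc h'),
              by_contra fun h' => h (mem_ground hc' h'), sub_zero]
          exact (hgg' x ⟨hxE, hxN⟩).symm
        rw [h2, map_sub, h1, sub_zero] at h3
        exact h3
      · push Not at hcN
        exact hg.2.1 c ⟨hc, fun x hx => ⟨mem_ground hc hx, fun h => hx (hcN x h)⟩⟩
    obtain ⟨e, he⟩ : ∃ e, g e < 0 := by
      by_contra! h
      have : {x | g x < 0} = ∅ := by
        ext x
        simpa using h x
      simp [this] at hlt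
    have heE : e ∈ S.M.E := by_contra fun h => by simp [hgE e h] at he
    rcases S.painting g heE he.ne with ⟨c, hc, hce, h⟩ | ⟨d, hd, hde, h⟩
    · exact (pairing_pos h (lt_of_le_of_ne (h e) (mul_ne_zero hce he.ne).symm)).ne'
        (horth c hc)
    · obtain ⟨t, ht⟩ := hg.eq_mul (g' := d) (fun c hc => hd.2.1 c hc.1) fun x _ hgx =>
        (h x).resolve_right fun h' => by simp [hgx] at h'
      have hdN : ∀ x, g x = 0 → d x = 0 := fun x hx =>
        (h x).resolve_right fun h' => by simp [hx] at h'
      have ht0 : 0 < t := by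
        have h1 := (h e).resolve_left hde
        rw [ht e ⟨heE, fun h' => by simp [hgN e h'] at he⟩, mul_assoc] at h1
        exact pos_of_mul_pos_left h1 (mul_self_nonneg _)
      have hdt : ∀ x, d x = t * g x := by
        intro x
        by_cases hx : x ∈ S.M.E \ N
        · exact ht x hx
        · rw [hg.1 x hx, hdN x (hg.1 x hx), mul_zero]
      have := hS d hd
      simp only [hdt, mul_pos_iff_of_pos_left ht0, mul_neg_iff_of_pos ht0] at this
      exact hlt.ne this

/-- Balancedness passes to a set `X` of size at most `θ`, provided that the parts outside `X` of
circuits can be reflected into `X`, avoiding any given set of size less than `θ`. -/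
lemma Balanced.restr_of_reflect (hS : S.Balanced) {θ : Cardinal.{u}} (hX : X ⊆ S.M.E)
    (hXθ : #X ≤ θ)
    (hrich : ∀ c ∈ S.circ, (∀ x, x ∉ X → c x ≤ 0) → ∀ U : Set α, #U < θ →
      ∃ c' ∈ S.circ, (∀ x, c' x ≠ 0 → x ∈ X) ∧ (∀ x ∈ X, c x ≠ 0 → c' x = c x) ∧
        (∀ x, c x = 0 → c' x ≤ 0) ∧ ∀ x ∈ U, c x = 0 → c' x = 0) :
    (S.restr X hX).Balanced := by
  classical
  refine balanced_of_not_lt fun g hg hlt => ?_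
  obtain ⟨e, he⟩ : ∃ e, g e < 0 := by
    by_contra! h
    have : {x | g x < 0} = ∅ := by
      ext x
      simpa using h x
    simp [this] at hlt
  have heX : e ∈ X := by_contra fun h => by simp [hg.1 e h] at he
  have hnegX : #{x | g x < 0} ≤ θ := (mk_le_mk_of_subset fun x hx => by
    by_contra h
    have : g x = 0 := hg.1 x h
    simp [this] at hx).trans hXθ
  -- Prescribing `-1` off `X` makes a cocircuit alternative gain only negative entries there, which
  -- worsens the imbalance of `g`. A circuit alternative is nonpositive off `X`; its reflection into
  -- `X`, avoiding the positive entries of `g`, would have positive pairing with `g`.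
  set σ : α → ℤ := fun x => if x ∈ X then g x else -1 with hσ
  have hσX : ∀ x ∈ X, σ x = g x := fun x hx => if_pos hx
  have hσX' : ∀ x, x ∉ X → σ x = -1 := fun x hx => if_neg hx
  rcases S.painting σ (hX heX) (by rw [hσX e heX]; exact he.ne) with
    ⟨c, hc, hce, h⟩ | ⟨d, hd, hde, h⟩
  · obtain ⟨c', hc', hc'X, hc'c, hc'n, hc'U⟩ := hrich c hc (fun x hx => by
      have := h x
      rw [hσX' x hx] at this
      linarith) {x | 0 < g x} (hlt.trans_le hnegX)
    have hpos : 0 < pairing g c' := by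
      refine pairing_pos (e := e) (fun x => ?_) ?_
      · by_cases hxX : x ∈ X
        swap
        · rw [hg.1 x hxX, mul_zero]
        by_cases hcx : c x = 0
        · by_cases hgx : 0 < g x
          · rw [hc'U x hgx hcx, zero_mul]
          · exact mul_nonneg_of_nonpos_of_nonpos (hc'n x hcx) (not_lt.1 hgx)
        · have := h x
          rwa [hσX x hxX, ← hc'c x hxX hcx] at this
      · rw [hc'c e heX hce]
        have := h e
        rw [hσX e heX] at this
        exact lt_of_le_of_ne this (mul_ne_zero hce he.ne).symm
    exact hpos.ne' (hg.2.1 c' ⟨hc', hc'X⟩)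
  · obtain ⟨t, ht⟩ := hg.eq_mul (g' := d) (fun c hc => hd.2.1 c hc.1) fun x hx hgx =>
      (h x).resolve_right fun h' => by simp [hσX x hx, hgx] at h'
    have ht0 : 0 < t := by
      have h1 := (h e).resolve_left hde
      rw [hσX e heX, ht e heX, mul_assoc] at h1
      exact pos_of_mul_pos_left h1 (mul_self_nonneg _)
    have h1 : {x | 0 < d x} ⊆ {x | 0 < g x} := by
      intro x hx
      rw [mem_ofPred_eq] at hx ⊢
      by_cases hxX : x ∈ X
      · rwa [ht x hxX, mul_pos_iff_of_pos_left ht0] at hx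
      · have := (h x).resolve_left hx.ne'
        rw [hσX' x hxX] at this
        linarith
    have h2 : {x | g x < 0} ⊆ {x | d x < 0} := by
      intro x hx
      rw [mem_ofPred_eq] at hx ⊢
      have hxX : x ∈ X := by_contra fun h => by
        have : g x = 0 := hg.1 x h
        simp [this] at hx
      rw [ht x hxX]
      exact mul_neg_of_pos_of_neg ht0 hx
    exact (((mk_le_mk_of_subset h1).trans_lt hlt).trans_le (mk_le_mk_of_subset h2)).ne (hS d hd)

end RegularSystem

/-! ### Chains, disjoint families and closures of sets -/

section SetFamilies

variable {α : Type u}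

/-- Well-founded construction of a chain of sets, where each step may depend on the union of the
previous ones. -/
lemma exists_chain {I : Type*} [LinearOrder I] [WellFoundedLT I] (Ok : I → Set α → Prop)
    (Q : I → Set α → Set α → Prop) (hstep : ∀ i P, Ok i P → ∃ N, Q i P N)
    (hlim : ∀ i (N : I → Set α), (∀ k < i, Q k (⋃ j ∈ Iio k, N j) (N k)) →
      Ok i (⋃ j ∈ Iio i, N j)) :
    ∃ N : I → Set α, ∀ i, Q i (⋃ j ∈ Iio i, N j) (N i) := by
  classical
  set step : I → Set α → Set α := fun i P => if h : Ok i P then (hstep i P h).choose else ∅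
  have hQ : ∀ i P, Ok i P → Q i P (step i P) := fun i P h => by
    simp only [step, dif_pos h]
    exact (hstep i P h).choose_spec
  set N : I → Set α := wellFounded_lt.fix fun i ih => step i (⋃ j, ⋃ h : j ∈ Iio i, ih j h)
  have hN : ∀ i, N i = step i (⋃ j ∈ Iio i, N j) := fun i => wellFounded_lt.fix_eq _ i
  refine ⟨N, fun i => ?_⟩
  induction i using WellFoundedLT.induction with
  | _ i ih =>
  rw [hN i]
  exact hQ i _ (hlim i N ih)

/-- The set `E` is partitioned into sets with property `P`. -/
def PartitionsInto (P : Set α → Prop) (E : Set α) : Prop :=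
  ∃ 𝒜 : Set (Set α), 𝒜.PairwiseDisjoint id ∧ ⋃₀ 𝒜 = E ∧ ∀ A ∈ 𝒜, P A

/-- Each element is assigned to the least index whose set contains it. -/
lemma partitionsInto_of_chain {I : Type*} [LinearOrder I] [WellFoundedLT I] {P : Set α → Prop}
    (N : I → Set α) (h : ∀ i, PartitionsInto P (N i \ ⋃ j ∈ Iio i, N j)) :
    PartitionsInto P (⋃ i, N i) := by
  choose 𝒜 hdisj hcover hP using h
  have hsub : ∀ i, ∀ A ∈ 𝒜 i, A ⊆ N i \ ⋃ j ∈ Iio i, N j := fun i A hA => by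
    rw [← hcover i]
    exact subset_sUnion_of_mem hA
  have hlt : ∀ i j, i < j → ∀ A ∈ 𝒜 i, ∀ B ∈ 𝒜 j, Disjoint A B := by
    intro i j hij A hA B hB
    refine disjoint_left.2 fun x hxA hxB => (hsub j B hB hxB).2 ?_
    exact mem_biUnion (show i ∈ Iio j from hij) (hsub i A hA hxA).1
  refine ⟨⋃ i, 𝒜 i, ?_, ?_, ?_⟩
  · intro A hA B hB hAB
    obtain ⟨i, hi⟩ := mem_iUnion.1 hA
    obtain ⟨j, hj⟩ := mem_iUnion.1 hB
    rcases lt_trichotomy i j with hij | hij | hij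
    · exact hlt i j hij A hi B hj
    · subst hij
      exact hdisj i hi hj hAB
    · exact (hlt j i hij B hj A hi).symm
  · refine subset_antisymm (sUnion_subset fun A hA => ?_) fun x hx => ?_
    · obtain ⟨i, hi⟩ := mem_iUnion.1 hA
      exact ((hsub i A hi).trans sdiff_subset).trans (subset_iUnion N i)
    · obtain ⟨i, hi, hmin⟩ := wellFounded_lt.has_min {i | x ∈ N i} (mem_iUnion.1 hx)
      have hx' : x ∈ N i \ ⋃ j ∈ Iio i, N j := by
        refine ⟨hi, fun h => ?_⟩
        obtain ⟨j, hj, hxj⟩ := mem_iUnion₂.1 h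
        exact hmin j hxj hj
      rw [← hcover i] at hx'
      obtain ⟨A, hA, hxA⟩ := hx'
      exact ⟨A, mem_iUnion.2 ⟨i, hA⟩, hxA⟩
  · intro A hA
    obtain ⟨i, hi⟩ := mem_iUnion.1 hA
    exact hP i A hi

/-- A family of sets has a disjoint subfamily of size at most `θ` which either has size `θ` or
meets every nonempty member of the family. -/
lemma exists_disjoint_subfamily (𝒲 : Set (Set α)) (θ : Cardinal.{u}) :
    ∃ 𝒢 ⊆ 𝒲, 𝒢.PairwiseDisjoint id ∧ #𝒢 ≤ θ ∧
      (#𝒢 = θ ∨ ∀ W ∈ 𝒲, W.Nonempty → ∃ G ∈ 𝒢, ¬ Disjoint W G) := by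
  obtain ⟨𝒢, h𝒢⟩ := zorn_subset {𝒢 : Set (Set α) | 𝒢 ⊆ 𝒲 ∧ 𝒢.PairwiseDisjoint id} (by
    intro 𝒞 h𝒞 hchain
    refine ⟨⋃₀ 𝒞, ⟨sUnion_subset fun R hR => (h𝒞 hR).1, ?_⟩, fun R hR => subset_sUnion_of_mem hR⟩
    exact (pairwiseDisjoint_sUnion hchain.directedOn).2 fun R hR => (h𝒞 hR).2)
  by_cases hθ : #𝒢 ≤ θ
  · refine ⟨𝒢, h𝒢.prop.1, h𝒢.prop.2, hθ, Or.inr fun W hW hne => ?_⟩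
    by_contra! hcon
    have hW' : W ∈ 𝒢 := h𝒢.le_of_ge (y := insert W 𝒢)
      ⟨insert_subset hW h𝒢.prop.1, h𝒢.prop.2.insert fun G hG _ => hcon G hG⟩
      (subset_insert _ _) (mem_insert _ _)
    exact hne.ne_empty (disjoint_self.1 (hcon W hW'))
  · obtain ⟨𝒢', h𝒢', hcard⟩ := le_mk_iff_exists_subset.1 (not_le.1 hθ).le
    exact ⟨𝒢', h𝒢'.trans h𝒢.prop.1, h𝒢.prop.2.subset h𝒢', hcard.le, Or.inl hcard⟩

/-- Enumeration of a set in the order type of its cardinal. -/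
lemma exists_ordinal_rank (H : Set α) :
    ∃ r : α → Ordinal.{u}, InjOn r H ∧ ∀ h ∈ H, r h < (#H).ord := by
  classical
  obtain ⟨s, hs, hord⟩ := Cardinal.exists_ord_eq H
  refine ⟨fun h => if hh : h ∈ H then Ordinal.typein s ⟨h, hh⟩ else 0, ?_, ?_⟩
  · intro a ha b hb hab
    simp only [dif_pos ha, dif_pos hb] at hab
    exact congrArg Subtype.val (Ordinal.typein_injective s hab)
  · intro h hh
    simp only [dif_pos hh, hord]
    exact Ordinal.typein_lt_type s _

lemma mk_rank_le {H : Set α} {r : α → Ordinal.{u}} (hr : InjOn r H) {o : Ordinal.{u}}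
    (ho : ℵ₀ ≤ o.card) : #{h ∈ H | r h ≤ o} ≤ o.card := by
  have h1 : Cardinal.lift.{u + 1} #{h ∈ H | r h ≤ o} ≤ #(Iio (o + 1)) := by
    have : Cardinal.lift.{u + 1} #{h ∈ H | r h ≤ o} ≤ Cardinal.lift.{u} #(Iio (o + 1)) :=
      Cardinal.lift_mk_le_lift_mk_of_injective (f := fun h : {h ∈ H | r h ≤ o} =>
        (⟨r h, Order.lt_succ_iff.2 h.2.2⟩ : Iio (o + 1)))
        fun a b hab => Subtype.ext (hr a.2.1 b.2.1 (congrArg Subtype.val hab))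
    simpa using this
  rw [Cardinal.mk_Iio_ordinal, Cardinal.lift_le, Ordinal.card_add_one] at h1
  exact h1.trans (add_one_eq ho).le

lemma mk_finsupp_support_subset_le {N : Set α} {θ : Cardinal.{u}} (hθ : ℵ₀ ≤ θ) (hN : #N ≤ θ) :
    #{x : α →₀ ℤ | (x.support : Set α) ⊆ N} ≤ θ := by
  classical
  have h1 : #{x : α →₀ ℤ | (x.support : Set α) ⊆ N} ≤ #(N →₀ ℤ) := by
    refine mk_le_of_injective (f := fun x => x.1.subtypeDomain (· ∈ N)) fun x y hxy => ?_
    refine Subtype.ext (Finsupp.ext fun a => ?_)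
    by_cases ha : a ∈ N
    · exact DFunLike.congr_fun hxy ⟨a, ha⟩
    · rw [Finsupp.notMem_support_iff.1 fun h => ha (x.2 h),
        Finsupp.notMem_support_iff.1 fun h => ha (y.2 h)]
  refine h1.trans ?_
  rcases isEmpty_or_nonempty N with h | h
  · exact (le_one_iff_subsingleton.2 inferInstance).trans (one_le_aleph0.trans hθ)
  · simp [hθ, hN]

/-- Closure of a set under a set-valued operation on finitely supported vectors. -/
lemma exists_closed_superset {θ : Cardinal.{u}} (hθ : ℵ₀ ≤ θ) (T : (α →₀ ℤ) → Set α)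
    (hT : ∀ x, #(T x) ≤ θ) {A E : Set α} (hA : #A ≤ θ) (hAE : A ⊆ E) (hTE : ∀ x, T x ⊆ E) :
    ∃ N, A ⊆ N ∧ N ⊆ E ∧ #N ≤ θ ∧ ∀ x : α →₀ ℤ, (x.support : Set α) ⊆ N → T x ⊆ N := by
  set F : ℕ → Set α := fun n => n.rec A fun _ N =>
    N ∪ ⋃ x ∈ {x : α →₀ ℤ | (x.support : Set α) ⊆ N}, T x
    with hF
  have hF0 : F 0 = A := rfl
  have hFs : ∀ n, F (n + 1) = F n ∪ ⋃ x ∈ {x : α →₀ ℤ | (x.support : Set α) ⊆ F n}, T x :=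
    fun n => rfl
  have hmono : Monotone F := monotone_nat_of_le_succ fun n => by
    rw [hFs]
    exact subset_union_left
  have hcard : ∀ n, #(F n) ≤ θ := by
    intro n
    induction n with
    | zero => exact hA
    | succ n ih =>
      rw [hFs]
      refine (mk_union_le _ _).trans ((add_le_add ih ?_).trans (add_eq_self hθ).le)
      refine (mk_biUnion_le _ _).trans ?_
      refine (mul_le_mul' (mk_finsupp_support_subset_le hθ ih) (ciSup_le' fun _ => hT _)).trans
        (mul_eq_self hθ).le
  have hFE : ∀ n, F n ⊆ E := by
    intro n
    induction n with
    | zero => exact hAE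
    | succ n ih =>
      rw [hFs]
      exact union_subset ih (iUnion₂_subset fun x _ => hTE x)
  refine ⟨⋃ n, F n, subset_iUnion F 0, iUnion_subset hFE, ?_, fun x hx => ?_⟩
  · have := mk_iUnion_le_lift F
    simp only [mk_nat, lift_aleph0, lift_uzero] at this
    refine this.trans ((mul_le_mul' hθ (ciSup_le' hcard)).trans (mul_eq_self hθ).le)
  -- A finite support is caught at a finite stage, so countably many rounds suffice.
  · obtain ⟨n, hn⟩ : ∃ n, (x.support : Set α) ⊆ F n :=
      (hmono.directed_le).exists_mem_subset_of_finset_subset_biUnion (by simpa using hx)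
    refine Subset.trans ?_ (subset_iUnion F (n + 1))
    rw [hFs]
    exact subset_union_of_subset_right (subset_biUnion_of_mem (u := T)
      (show x ∈ {x : α →₀ ℤ | (x.support : Set α) ⊆ F n} from hn)) _

end SetFamilies

/-! ### The countable case and reflection of circuits -/

namespace RegularSystem

variable {α : Type u} {S : RegularSystem α}

lemma restr_restr {X Y : Set α} (hX : X ⊆ S.M.E) (hY : Y ⊆ X) :
    (S.restr X hX).restr Y hY = S.restr Y (hY.trans hX) := by
  simp only [restr, RegularSystem.mk.injEq]
  refine ⟨S.M.restrict_restrict_eq hY, ?_⟩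
  ext c
  exact ⟨fun h => ⟨h.1.1, h.2⟩, fun h => ⟨⟨h.1, fun x hx => hY (h.2 x hx)⟩, h.2⟩⟩

lemma Balanced.of_restr_restr {X Y : Set α} {hX : X ⊆ S.M.E} (hY : Y ⊆ X)
    (h : ((S.restr X hX).restr Y hY).Balanced) : (S.restr Y (hY.trans hX)).Balanced :=
  restr_restr hX hY ▸ h

lemma Balanced.congr_set {X Y : Set α} {hX : X ⊆ S.M.E} (h : (S.restr X hX).Balanced)
    (hXY : X = Y) {hY : Y ⊆ S.M.E} : (S.restr Y hY).Balanced := by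
  subst hXY
  exact h

lemma Balanced.restr_diff_empty (hS : S.Balanced) {P : Set α} (hP : P = ∅) :
    (S.restr (S.M.E \ P) sdiff_subset).Balanced := by
  have : (S.restr S.M.E subset_rfl).Balanced := by rwa [restr_ground]
  exact this.congr_set (by rw [hP, sdiff_empty])

/-- The property of being the underlying set of a nonnegative circuit. -/
def IsNonnegCircuit (S : RegularSystem α) (A : Set α) : Prop :=
  ∃ c ∈ S.circ, (∀ x, 0 ≤ c x) ∧ {x | c x ≠ 0} = A

/-- Following an enumeration, each element not yet covered receives a nonnegative circuit in the
remaining balanced system. Every stage has only finitely many predecessors, so no limit step arises.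
-/
lemma Balanced.partition_of_countable (hS : S.Balanced) (hE : S.M.E.Countable) :
    PartitionsInto S.IsNonnegCircuit S.M.E := by
  rcases S.M.E.eq_empty_or_nonempty with hemp | hne
  · exact ⟨∅, by simp, by simp [hemp], by simp⟩
  obtain ⟨e, he⟩ := hE.exists_eq_range hne
  have heE : ∀ i, e i ∈ S.M.E := fun i => he ▸ mem_range_self i
  obtain ⟨N, hN⟩ := exists_chain (α := α)
    (fun (_ : ℕ) P => P ⊆ S.M.E ∧ (S.restr (S.M.E \ P) sdiff_subset).Balanced)
    (fun i P N => P ⊆ N ∧ N ⊆ S.M.E ∧ e i ∈ N ∧ (S.restr (S.M.E \ N) sdiff_subset).Balanced ∧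
      (N \ P = ∅ ∨ S.IsNonnegCircuit (N \ P)))
    (by
      rintro i P ⟨hPE, hbal⟩
      by_cases hi : e i ∈ P
      · exact ⟨P, subset_rfl, hPE, hi, hbal, Or.inl (Set.sdiff_self)⟩
      obtain ⟨c, hc, hce, hc0⟩ := hbal.exists_nonneg_circ (e := e i) ⟨heE i, hi⟩
      have hcE : {x | c x ≠ 0} ⊆ S.M.E \ P := fun x hx => hc.2 x hx
      refine ⟨P ∪ {x | c x ≠ 0}, subset_union_left, union_subset hPE (hcE.trans sdiff_subset),
        Or.inr hce, ?_, Or.inr ⟨c, hc.1, hc0, ?_⟩⟩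
      · exact (Balanced.of_restr_restr sdiff_subset
          (hbal.restr_diff_circ hc hc0)).congr_set sdiff_sdiff
      · rw [union_sdiff_left]
        exact (sdiff_eq_left.2 (disjoint_left.2 fun x hx hxP => (hcE hx).2 hxP)).symm)
    (by
      intro i N hN
      rcases i with _ | i
      · have : (⋃ j ∈ Iio 0, N j) = ∅ := by simp
        exact ⟨by simp, hS.restr_diff_empty this⟩
      · obtain ⟨h1, h2, h3, h4, h5⟩ := hN i (Nat.lt_succ_self i)
        have : (⋃ j ∈ Iio (i + 1), N j) = N i := by
          refine subset_antisymm (iUnion₂_subset fun j hj => ?_)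
            (subset_biUnion_of_mem (u := N) (show i ∈ Iio (i + 1) from Nat.lt_succ_self i))
          rcases (Nat.lt_succ_iff.1 hj).eq_or_lt with rfl | hj
          · exact subset_rfl
          · exact (subset_biUnion_of_mem (u := N) (show j ∈ Iio i from hj)).trans h1
        rw [this]
        exact ⟨h2, h4⟩)
  have hEN : S.M.E = ⋃ i, N i := by
    refine subset_antisymm (fun x hx => ?_) (iUnion_subset fun i => (hN i).2.1)
    rw [he] at hx
    obtain ⟨i, rfl⟩ := hx
    exact mem_iUnion.2 ⟨i, (hN i).2.2.1⟩
  rw [hEN]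
  refine partitionsInto_of_chain N fun i => ?_
  rcases (hN i).2.2.2.2 with h | h
  · exact ⟨∅, pairwiseDisjoint_empty, sUnion_empty.trans h.symm, by simp⟩
  · exact ⟨{_}, pairwiseDisjoint_singleton _ _, sUnion_singleton _,
      by simpa only [mem_singleton_iff, forall_eq] using h⟩

/-- The possible continuations of a vector `x` by a circuit that is nonpositive off the support
of `x`. -/
def continuations (S : RegularSystem α) (x : α →₀ ℤ) : Set (Set α) :=
  {W | ∃ c ∈ S.circ, (∀ y, x y ≠ 0 → c y = x y) ∧ (∀ y, x y = 0 → c y ≤ 0) ∧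
    W = {y | c y ≠ 0 ∧ x y = 0}}

/-- Closure under sufficiently many continuations preserves balancedness. -/
lemma Balanced.restr_of_closed (hS : S.Balanced) {θ : Cardinal.{u}} {X : Set α} (hX : X ⊆ S.M.E)
    (hXθ : #X ≤ θ) (𝒢 : (α →₀ ℤ) → Set (Set α)) (h𝒢 : ∀ x, 𝒢 x ⊆ S.continuations x)
    (hdisj : ∀ x, (𝒢 x).PairwiseDisjoint id)
    (hmax : ∀ x, #(𝒢 x) = θ ∨ ∀ W ∈ S.continuations x, W.Nonempty → ∃ G ∈ 𝒢 x, ¬ Disjoint W G)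
    (hcl : ∀ x : α →₀ ℤ, (x.support : Set α) ⊆ X → ⋃₀ 𝒢 x ⊆ X) :
    (S.restr X hX).Balanced := by
  classical
  refine hS.restr_of_reflect hX hXθ fun c hc hcX U hU => ?_
  set x : α →₀ ℤ := c.filter (· ∈ X) with hx
  have hx1 : ∀ y ∈ X, x y = c y := fun y hy => Finsupp.filter_apply_pos _ _ hy
  have hx2 : ∀ y, y ∉ X → x y = 0 := fun y hy => Finsupp.filter_apply_neg _ _ hy
  have hxX : (x.support : Set α) ⊆ X := fun y hy => by
    by_contra h
    exact Finsupp.mem_support_iff.1 hy (hx2 y h)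
  have hxc : ∀ y, x y ≠ 0 → c y = x y := fun y hy =>
    (hx1 y (by_contra fun h => hy (hx2 y h))).symm
  have hxn : ∀ y, x y = 0 → c y ≤ 0 := fun y hy => by
    by_cases h : y ∈ X
    · rw [← hx1 y h, hy]
    · exact hcX y h
  by_cases hW : ∀ y, c y ≠ 0 → y ∈ X
  · exact ⟨c, hc, hW, fun _ _ _ => rfl, fun _ h => h.le, fun _ _ h => h⟩
  push Not at hW
  obtain ⟨w, hw, hwX⟩ := hW
  -- The part of `c` outside `X` is a nonempty continuation of `x` disjoint from all members of `𝒢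
  -- x`, which lie in `X`. So `𝒢 x` does not meet every continuation and must have size `θ`; fewer
  -- than `θ` elements cannot meet all its disjoint members.
  have hcard : #(𝒢 x) = θ := by
    refine (hmax x).resolve_right fun h => ?_
    obtain ⟨G, hG, hdis⟩ := h _ ⟨c, hc, hxc, hxn, rfl⟩ ⟨w, hw, hx2 w hwX⟩
    refine hdis (disjoint_left.2 fun y hy hyG => hy.1 ?_)
    rw [← hx1 y (hcl x hxX ⟨G, hG, hyG⟩), hy.2]
  obtain ⟨G, hG, hGU⟩ : ∃ G ∈ 𝒢 x, Disjoint G U := by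
    by_contra! hcon
    have : ∀ G : 𝒢 x, ∃ u : U, (u : α) ∈ (G : Set α) := fun G => by
      obtain ⟨u, hu, huU⟩ := not_disjoint_iff.1 (hcon G G.2)
      exact ⟨⟨u, huU⟩, hu⟩
    choose f hf using this
    have hinj : Function.Injective f := fun G G' h => by
      by_contra hne
      have := hdisj x G.2 G'.2 fun h => hne (Subtype.ext h)
      exact disjoint_left.1 this (hf G) (h ▸ hf G')
    have := mk_le_of_injective hinj
    rw [hcard] at this
    exact absurd hU (not_lt.2 this)
  obtain ⟨c', hc', hc'x, hc'n, rfl⟩ := h𝒢 x hG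
  have h0 : ∀ y, c y = 0 → x y = 0 := fun y hy => by
    by_contra h
    exact h ((hxc y h).symm.trans hy)
  refine ⟨c', hc', fun y hy => ?_, fun y hy hcy => ?_, fun y hy => hc'n y (h0 y hy),
    fun u hu huc => ?_⟩
  · by_cases h : x y = 0
    · exact hcl x hxX ⟨_, hG, hy, h⟩
    · exact by_contra fun h' => h (hx2 y h')
  · rw [← hx1 y hy] at hcy ⊢
    exact hc'x y hcy
  · by_contra h
    exact disjoint_left.1 hGU ⟨h, h0 u huc⟩ hu

end RegularSystem

/-! ### Hitting sets and the uncountable case -/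

namespace RegularSystem

variable {α : Type u} {S : RegularSystem α}

/-- `H` meets, outside the support of `x`, every circuit that extends `x` and leaves its support. -/
def Hits (S : RegularSystem α) (x : α →₀ ℤ) (H : Set α) : Prop :=
  H ⊆ S.M.E ∧ ∀ c ∈ S.circ, (∀ y, x y ≠ 0 → c y = x y) → (∃ y, c y ≠ 0 ∧ x y = 0) →
    ∃ y ∈ H, c y ≠ 0 ∧ x y = 0

lemma exists_min_hits (S : RegularSystem α) (x : α →₀ ℤ) :
    ∃ H, S.Hits x H ∧ ∀ H', S.Hits x H' → #H ≤ #H' := by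
  obtain ⟨H, hH, hmin⟩ := (InvImage.wf (fun H : Set α => #H) Cardinal.lt_wf).has_min
    {H | S.Hits x H} ⟨S.M.E, subset_rfl, fun c hc _ ⟨y, hy, hxy⟩ => ⟨y, mem_ground hc hy, hy, hxy⟩⟩
  exact ⟨H, hH, fun H' hH' => not_lt.1 (hmin H' hH')⟩

/-- If `P` contains each minimum hitting set of size at most `θ` that belongs to a nonzero vector
supported in `P`, then balancedness passes to the complement of `P`. -/
lemma Balanced.restr_diff_of_hits (hS : S.Balanced) {P : Set α} {θ : Cardinal.{u}} (hθ : ℵ₀ ≤ θ)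
    (hP : #P ≤ θ) (H : (α →₀ ℤ) → Set α) (hH : ∀ x, S.Hits x (H x))
    (hmin : ∀ x H', S.Hits x H' → #(H x) ≤ #H')
    (hcl : ∀ x : α →₀ ℤ, x ≠ 0 → (x.support : Set α) ⊆ P → #(H x) ≤ θ → H x ⊆ P) :
    (S.restr (S.M.E \ P) sdiff_subset).Balanced := by
  classical
  refine hS.restr_diff hθ hP fun c hc ⟨x₀, hx₀P, hx₀⟩ U hU => ?_
  set x : α →₀ ℤ := c.filter (· ∈ P) with hx
  have hx1 : ∀ y ∈ P, x y = c y := fun y hy => Finsupp.filter_apply_pos _ _ hy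
  have hx2 : ∀ y, y ∉ P → x y = 0 := fun y hy => Finsupp.filter_apply_neg _ _ hy
  have hxP : (x.support : Set α) ⊆ P := fun y hy => by
    by_contra h
    exact Finsupp.mem_support_iff.1 hy (hx2 y h)
  have hxc : ∀ y, x y ≠ 0 → c y = x y := fun y hy =>
    (hx1 y (by_contra fun h => hy (hx2 y h))).symm
  have hxne : x ≠ 0 := fun h => hx₀ (by rw [← hx1 x₀ hx₀P, h, Finsupp.zero_apply])
  by_cases hcP : ∀ y, c y ≠ 0 → y ∈ P
  · exact ⟨c, hc, fun _ _ => rfl, fun y _ hyP => by_contra fun h => hyP (hcP y h)⟩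
  push Not at hcP
  obtain ⟨w, hw, hwP⟩ := hcP
  -- A hitting set of size at most `θ` would lie in `P`, where `c` has no elements outside the
  -- support of `x`.
  have hbig : θ < #(H x) := by
    by_contra hle
    have hsub := hcl x hxne hxP (not_lt.1 hle)
    obtain ⟨y, hyH, hcy, hxy⟩ := (hH x).2 c hc hxc ⟨w, hw, hx2 w hwP⟩
    exact hcy (by rw [← hx1 y (hsub hyH), hxy])
  -- Being too small to hit, `P ∪ U` is missed outside the support of `x` by some circuit extending
  -- `x`; this is the rerouted circuit.
  have hnot : ¬ S.Hits x ((P ∪ U) ∩ S.M.E) := fun h => by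
    have h1 := hmin x _ h
    have h2 : #((P ∪ U) ∩ S.M.E : Set α) ≤ θ :=
      (mk_le_mk_of_subset inter_subset_left).trans
        ((mk_union_le _ _).trans ((add_le_add hP hU).trans (add_eq_self hθ).le))
    exact absurd hbig (not_lt.2 (h1.trans h2))
  simp only [Hits, inter_subset_right, true_and] at hnot
  push Not at hnot
  obtain ⟨c', hc', hc'x, -, hc'0⟩ := hnot
  have h0 : ∀ y ∈ P ∪ U, x y = 0 → c' y = 0 := fun y hy hxy => by
    by_contra h
    exact hc'0 y ⟨hy, mem_ground hc' h⟩ h hxy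
  refine ⟨c', hc', fun y hy => ?_, fun y hy hyP => h0 y (Or.inr hy) (hx2 y hyP)⟩
  by_cases hxy : x y = 0
  · rw [h0 y (Or.inl hy) hxy, ← hx1 y hy, hxy]
  · rw [hc'x y hxy, hx1 y hy]

lemma mk_sUnion_continuations_le {θ : Cardinal.{u}} (hθ : ℵ₀ ≤ θ) {x : α →₀ ℤ}
    {𝒢 : Set (Set α)} (h𝒢 : 𝒢 ⊆ S.continuations x) (hcard : #𝒢 ≤ θ) : #(⋃₀ 𝒢) ≤ θ := by
  rw [sUnion_eq_iUnion]
  refine (mk_iUnion_le _).trans ((mul_le_mul' hcard (ciSup_le' fun W => ?_)).trans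
    (mul_eq_self hθ).le)
  obtain ⟨c, -, -, -, hW⟩ := h𝒢 W.2
  have : (W : Set α).Finite := hW ▸ c.hasFiniteSupport.subset fun y hy => hy.1
  exact (lt_aleph0_iff_set_finite.2 this).le.trans hθ

lemma sUnion_continuations_subset {x : α →₀ ℤ} {𝒢 : Set (Set α)}
    (h𝒢 : 𝒢 ⊆ S.continuations x) : ⋃₀ 𝒢 ⊆ S.M.E := by
  refine sUnion_subset fun W hW y hy => ?_
  obtain ⟨c, hc, -, -, rfl⟩ := h𝒢 hW
  exact mem_ground hc hy.1

/-- Induction on the size of the ground set. In the uncountable case the chain is indexed by the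
initial ordinal of `κ`, and the sets `N i` are closed both under portions of minimum hitting sets,
which keeps the later complements balanced, and under disjoint continuations in the current
complement, which makes the differences balanced. -/
theorem Balanced.partition (hS : S.Balanced) : PartitionsInto S.IsNonnegCircuit S.M.E := by
  classical
  induction hκ : #S.M.E using WellFoundedLT.induction generalizing S with
  | _ κ ih =>
  rcases le_or_gt κ ℵ₀ with hκ0 | hκ0
  · exact hS.partition_of_countable (le_aleph0_iff_set_countable.1 (hκ.trans_le hκ0))
  obtain ⟨e⟩ : Nonempty (κ.ord.ToType ≃ S.M.E) := by
    rw [← Cardinal.eq, mk_ord_toType, hκ]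
  set t : κ.ord.ToType → Ordinal.{u} := fun i =>
    Ordinal.typein (α := κ.ord.ToType) (· < ·) i with ht
  set o : κ.ord.ToType → Ordinal.{u} := fun i => max Ordinal.omega0 (t i) with ho
  set θ : κ.ord.ToType → Cardinal.{u} := fun i => (o i).card with hθdef
  have hθ : ∀ i, ℵ₀ ≤ θ i := fun i => by
    rw [← Ordinal.card_omega0]
    exact Ordinal.card_le_card (le_max_left _ _)
  have hθκ : ∀ i, θ i < κ := fun i => by
    rw [← lt_ord]
    refine max_lt ?_ (Ordinal.typein_lt_self i)
    rwa [← ord_aleph0, ord_lt_ord]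
  have hto : ∀ i j, i < j → t i < t j := fun i j hij =>
    (Ordinal.typein_lt_typein (α := κ.ord.ToType) (· < ·)).2 hij
  have homono : ∀ i j, i ≤ j → o i ≤ o j := fun i j hij => by
    rcases hij.eq_or_lt with rfl | h
    · exact le_rfl
    · exact max_le_max le_rfl (hto i j h).le
  have hθmono : ∀ i j, i ≤ j → θ i ≤ θ j := fun i j hij => Ordinal.card_le_card (homono i j hij)
  choose H hH hHmin using S.exists_min_hits
  choose r hrinj hrlt using fun x => exists_ordinal_rank (H x)
  -- Hitting sets are absorbed gradually, at stage `i` up to rank `o i`. Absorbing only those of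
  -- size at most `θ i` whole would not suffice: `θ` can jump at a limit, and then the union must
  -- contain hitting sets larger than any earlier bound.
  obtain ⟨N, hN⟩ := exists_chain (α := α) (I := κ.ord.ToType)
    (fun i P => P ⊆ S.M.E ∧ #P ≤ θ i ∧ (S.restr (S.M.E \ P) sdiff_subset).Balanced)
    (fun i P N => P ⊆ N ∧ N ⊆ S.M.E ∧ (e i : α) ∈ N ∧ #N ≤ θ i ∧
      (∀ x : α →₀ ℤ, (x.support : Set α) ⊆ N → {h ∈ H x | r x h ≤ o i} ⊆ N) ∧
      ∀ h : N \ P ⊆ S.M.E, (S.restr (N \ P) h).Balanced)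
    (by
      rintro i P ⟨hPE, hPθ, hbal⟩
      choose 𝒢 h𝒢 hdisj hcard hmax using fun x => exists_disjoint_subfamily
        ((S.restr (S.M.E \ P) sdiff_subset).continuations x) (θ i)
      have h𝒢E : ∀ x, ⋃₀ 𝒢 x ⊆ S.M.E \ P := fun x => sUnion_continuations_subset (h𝒢 x)
      obtain ⟨N, hAN, hNE, hNθ, hNcl⟩ := exists_closed_superset (hθ i)
        (fun x => {h ∈ H x | r x h ≤ o i} ∪ ⋃₀ 𝒢 x)
        (fun x => (mk_union_le _ _).trans ((add_le_add (mk_rank_le (hrinj x) (hθ i))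
          (mk_sUnion_continuations_le (hθ i) (h𝒢 x) (hcard x))).trans (add_eq_self (hθ i)).le))
        (A := insert (e i : α) P) (E := S.M.E)
        ((mk_insert_le).trans ((add_le_add hPθ (one_le_aleph0.trans (hθ i))).trans
          (add_eq_self (hθ i)).le))
        (insert_subset (e i).2 hPE)
        (fun x => union_subset ((sep_subset _ _).trans (hH x).1) ((h𝒢E x).trans sdiff_subset))
      refine ⟨N, (subset_insert _ _).trans hAN, hNE, hAN (mem_insert _ _), hNθ,
        fun x hx => subset_union_left.trans (hNcl x hx), fun h => ?_⟩
      refine Balanced.of_restr_restr (hX := sdiff_subset) (sdiff_subset_sdiff_left hNE) ?_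
      refine hbal.restr_of_closed (sdiff_subset_sdiff_left hNE)
        ((mk_le_mk_of_subset sdiff_subset).trans hNθ) 𝒢 h𝒢 hdisj hmax fun x hx y hy => ?_
      exact ⟨hNcl x (hx.trans sdiff_subset) (Or.inr hy), (h𝒢E x hy).2⟩)
    (by
      intro i N hN
      have hmono : ∀ k j, k ≤ j → j < i → N k ⊆ N j := fun k j hkj hji => by
        rcases hkj.eq_or_lt with rfl | h
        · exact subset_rfl
        · exact (subset_biUnion_of_mem (u := N) (show k ∈ Iio j from h)).trans (hN j hji).1
      have hPθ : #(⋃ j ∈ Iio i, N j) ≤ θ i := by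
        refine (mk_biUnion_le _ _).trans ?_
        refine (mul_le_mul' ?_ (ciSup_le' fun j =>
          (hN _ j.2).2.2.2.1.trans (hθmono _ _ (le_of_lt j.2)))).trans (mul_eq_self (hθ i)).le
        have : #(Iio i) = (t i).card :=
          (Ordinal.card_typein (α := κ.ord.ToType) (r := (· < ·)) i).symm
        rw [this]
        exact Ordinal.card_le_card (le_max_right _ _)
      refine ⟨iUnion₂_subset fun j hj => (hN j hj).2.1, hPθ, ?_⟩
      refine hS.restr_diff_of_hits (hθ i) hPθ H hH hHmin fun x hx0 hxP hHθ h hh => ?_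
      -- The finite support of `x` lies in one earlier set. That `x ≠ 0` guarantees that an earlier
      -- index exists at all.
      obtain ⟨k, hki, hxk⟩ : ∃ k < i, (x.support : Set α) ⊆ N k := by
        have h1 : ∀ y : x.support, ∃ k < i, (y : α) ∈ N k := fun y => by
          obtain ⟨k, hk, hyk⟩ := mem_iUnion₂.1 (hxP y.2)
          exact ⟨k, hk, hyk⟩
        choose f hf hyf using h1
        have hne : (Finset.univ : Finset x.support).Nonempty := by
          obtain ⟨y, hy⟩ := Finsupp.support_nonempty_iff.2 hx0
          exact ⟨⟨y, hy⟩, Finset.mem_univ _⟩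
        obtain ⟨y, -, hy⟩ := Finset.exists_max_image Finset.univ f hne
        exact ⟨f y, hf y, fun z hz =>
          hmono _ _ (hy ⟨z, hz⟩ (Finset.mem_univ _)) (hf y) (hyf ⟨z, hz⟩)⟩
      -- The ranks run below the initial ordinal of `#(H x) ≤ θ i`, hence below `o i`; so each of
      -- them was reached at some stage before `i`.
      have hr : r x h < o i := (hrlt x h hh).trans_le ((ord_le_ord.2 hHθ).trans (ord_card_le _))
      obtain ⟨k', hk'i, hkk', hrk'⟩ : ∃ k' < i, k ≤ k' ∧ r x h ≤ o k' := by
        rcases lt_max_iff.1 hr with h1 | h1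
        · exact ⟨k, hki, le_rfl, h1.le.trans (le_max_left _ _)⟩
        · obtain ⟨j, hj⟩ : ∃ j, t j = r x h :=
            Ordinal.typein_surj (α := κ.ord.ToType) (· < ·)
              (h1.trans (Ordinal.typein_lt_type (α := κ.ord.ToType) (· < ·) i))
          have hji : j < i := by
            rw [← hj] at h1
            exact (Ordinal.typein_lt_typein (α := κ.ord.ToType) (· < ·)).1 h1
          refine ⟨max k j, max_lt hki hji, le_max_left _ _, ?_⟩
          rw [← hj]
          exact (le_max_right _ _).trans (homono _ _ (le_max_right _ _))
      exact mem_biUnion (show k' ∈ Iio i from hk'i) ((hN k' hk'i).2.2.2.2.1 x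
        (hxk.trans (hmono k k' hkk' hk'i)) ⟨hh, hrk'⟩))
  have hEN : S.M.E = ⋃ i, N i := by
    refine subset_antisymm (fun x hx => ?_) (iUnion_subset fun i => (hN i).2.1)
    refine mem_iUnion.2 ⟨e.symm ⟨x, hx⟩, ?_⟩
    have := (hN (e.symm ⟨x, hx⟩)).2.2.1
    rwa [Equiv.apply_symm_apply] at this
  rw [hEN]
  refine partitionsInto_of_chain N fun i => ?_
  obtain ⟨-, hNE, -, hNθ, -, hbal⟩ := hN i
  have hsub : N i \ ⋃ j ∈ Iio i, N j ⊆ S.M.E := sdiff_subset.trans hNE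
  obtain ⟨𝒜, h1, h2, h3⟩ := ih _ (((mk_le_mk_of_subset sdiff_subset).trans hNθ).trans_lt (hθκ i))
    (hbal hsub) rfl
  refine ⟨𝒜, h1, h2, fun A hA => ?_⟩
  obtain ⟨c, hc, h⟩ := h3 A hA
  exact ⟨c, hc.1, h⟩

end RegularSystem

/-! ### Signed sets as integer vectors -/

namespace SignedSet

variable {α : Type u}

open Classical in
/-- The `{0, ±1}`-valued function of a signed set. -/
noncomputable def vec (X : SignedSet α) (x : α) : ℤ :=
  if x ∈ X.pos then 1 else if x ∈ X.neg then -1 else 0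

variable {X Y : SignedSet α} {x : α}

lemma notMem_neg_of_mem_pos (h : x ∈ X.pos) : x ∉ X.neg := disjoint_left.1 X.disjoint h

@[simp] lemma vec_eq_one_iff : X.vec x = 1 ↔ x ∈ X.pos := by
  unfold vec
  split_ifs with h h' <;> simp [h]

@[simp] lemma vec_eq_neg_one_iff : X.vec x = -1 ↔ x ∈ X.neg := by
  unfold vec
  split_ifs with h h' <;> simp_all [notMem_neg_of_mem_pos]

lemma vec_ne_zero_iff : X.vec x ≠ 0 ↔ x ∈ X.support := by
  unfold vec support
  split_ifs with h h' <;> simp_all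

lemma vec_val (X : SignedSet α) (x : α) : X.vec x = 0 ∨ X.vec x = 1 ∨ X.vec x = -1 := by
  unfold vec
  split_ifs <;> simp

lemma support_vec (X : SignedSet α) : {x | X.vec x ≠ 0} = X.support := by
  ext x
  exact vec_ne_zero_iff

lemma neg_neg_eq (X : SignedSet α) : -(-X) = X := rfl

lemma support_neg (X : SignedSet α) : (-X).support = X.support := union_comm _ _

@[simp] lemma vec_neg (X : SignedSet α) (x : α) : (-X).vec x = -X.vec x := by
  rcases X.vec_val x with h | h | h
  · have h1 : x ∉ X.support := fun h' => vec_ne_zero_iff.2 h' h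
    rw [h, neg_zero]
    by_contra h2
    exact h1 (X.support_neg ▸ vec_ne_zero_iff.1 h2)
  · rw [h, vec_eq_neg_one_iff]
    exact vec_eq_one_iff.1 h
  · rw [h, neg_neg, vec_eq_one_iff]
    exact vec_eq_neg_one_iff.1 h

end SignedSet

/-! ### Unimodularity of binary oriented matroids -/

namespace FinitaryOrientedMatroid

variable {α : Type u} (M : FinitaryOrientedMatroid α)

/-- The signed circuits as integer vectors. -/
def circ : Set (α →₀ ℤ) := {c | ∃ C ∈ M.signedCircuits, ∀ x, c x = C.vec x}

variable {M} {c c' d : α →₀ ℤ} {B : Set α}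

lemma isCircuit_support {C : SignedSet α} (hC : C ∈ M.signedCircuits) :
    M.matroid.IsCircuit C.support := M.isSignature.1 C hC

lemma neg_mem_signedCircuits {C : SignedSet α} (hC : C ∈ M.signedCircuits) :
    -C ∈ M.signedCircuits := by
  obtain ⟨X, hX, -, hset⟩ := M.isSignature.2 _ (M.isSignature.1 C hC)
  have h1 : C ∈ ({X, -X} : Set (SignedSet α)) := hset ▸ ⟨hC, rfl⟩
  have h2 : -C ∈ ({X, -X} : Set (SignedSet α)) := by
    rcases h1 with rfl | h1
    · exact Or.inr rfl
    · rw [mem_singleton_iff.1 h1]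
      exact Or.inl (SignedSet.neg_neg_eq X)
  rw [← hset] at h2
  exact h2.1

lemma eq_or_eq_neg_of_support_eq {C C' : SignedSet α} (hC : C ∈ M.signedCircuits)
    (hC' : C' ∈ M.signedCircuits) (h : C'.support = C.support) : C' = C ∨ C' = -C := by
  obtain ⟨X, hX, -, hset⟩ := M.isSignature.2 _ (M.isSignature.1 C hC)
  have h1 : C ∈ ({X, -X} : Set (SignedSet α)) := hset ▸ ⟨hC, rfl⟩
  have h2 : C' ∈ ({X, -X} : Set (SignedSet α)) := hset ▸ ⟨hC', h⟩
  rcases h1 with h1 | h1 <;> rcases h2 with h2 | h2 <;> rw [h1, h2] <;>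
    simp [SignedSet.neg_neg_eq]

lemma exists_mem_circ {C : SignedSet α} (hC : C ∈ M.signedCircuits) :
    ∃ c ∈ M.circ, ∀ x, c x = C.vec x := by
  have := M.finitary
  have hfin : C.vec.support.Finite := by
    have := (isCircuit_support hC).finite
    rwa [← SignedSet.support_vec] at this
  exact ⟨Finsupp.ofSupportFinite _ hfin, ⟨C, hC, fun x => rfl⟩, fun x => rfl⟩

lemma neg_mem_circ (hc : c ∈ M.circ) : -c ∈ M.circ := by
  obtain ⟨C, hC, h⟩ := hc
  exact ⟨-C, neg_mem_signedCircuits hC, fun x => by simp [h]⟩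

lemma circ_val (hc : c ∈ M.circ) (x : α) : c x = 0 ∨ c x = 1 ∨ c x = -1 := by
  obtain ⟨C, hC, h⟩ := hc
  rw [h]
  exact C.vec_val x

lemma circ_isCircuit (hc : c ∈ M.circ) : M.matroid.IsCircuit {x | c x ≠ 0} := by
  obtain ⟨C, hC, h⟩ := hc
  simp only [h, C.support_vec]
  exact isCircuit_support hC

lemma exists_circ_of_isCircuit {C : Set α} (hC : M.matroid.IsCircuit C) :
    ∃ c ∈ M.circ, {x | c x ≠ 0} = C := by
  obtain ⟨X, hX, -, hset⟩ := M.isSignature.2 C hC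
  have h1 : X ∈ {Y ∈ M.signedCircuits | Y.support = C} := hset ▸ mem_insert _ _
  obtain ⟨c, hc, h⟩ := exists_mem_circ h1.1
  exact ⟨c, hc, by simp only [h, X.support_vec, hX]⟩

lemma circ_unique (hc : c ∈ M.circ) (hc' : c' ∈ M.circ)
    (h : {x | c' x ≠ 0} = {x | c x ≠ 0}) : c' = c ∨ c' = -c := by
  obtain ⟨C, hC, h1⟩ := hc
  obtain ⟨C', hC', h2⟩ := hc'
  simp only [h1, h2, SignedSet.support_vec] at h
  rcases eq_or_eq_neg_of_support_eq hC hC' h with rfl | rfl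
  · left; ext x; rw [h1, h2]
  · right; ext x; rw [Finsupp.neg_apply, h1, h2, SignedSet.vec_neg]

lemma circ_elim_aux (hc : c ∈ M.circ) (hc' : c' ∈ M.circ) {e : α} (he : c e = 1)
    (he' : c' e = -1) (hne : {x | c' x ≠ 0} ≠ {x | c x ≠ 0}) :
    ∃ d ∈ M.circ, d e = 0 ∧ ∀ x, d x ≠ 0 → d x = c x ∨ d x = c' x := by
  obtain ⟨C, hC, h1⟩ := hc
  obtain ⟨C', hC', h2⟩ := hc'
  simp only [h1, h2, SignedSet.support_vec] at hne he he'
  obtain ⟨D, hD, hn, hp⟩ := M.elimination C hC C' hC' (fun h => hne (by rw [h]))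
    (fun h => hne (by rw [h, SignedSet.support_neg])) e
    ⟨SignedSet.vec_eq_one_iff.1 he, SignedSet.vec_eq_neg_one_iff.1 he'⟩
  obtain ⟨d, hd, h3⟩ := exists_mem_circ hD
  refine ⟨d, hd, ?_, fun x hx => ?_⟩
  · rw [h3]
    by_contra h
    rcases SignedSet.vec_ne_zero_iff.1 h with h | h
    · exact (hp h).2 rfl
    · exact (hn h).2 rfl
  · rw [h3] at hx ⊢
    rw [h1, h2]
    rcases SignedSet.vec_ne_zero_iff.1 hx with h | h
    · rw [SignedSet.vec_eq_one_iff.2 h, eq_comm, SignedSet.vec_eq_one_iff, eq_comm,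
        SignedSet.vec_eq_one_iff]
      exact (hp h).1
    · rw [SignedSet.vec_eq_neg_one_iff.2 h, eq_comm, SignedSet.vec_eq_neg_one_iff, eq_comm,
        SignedSet.vec_eq_neg_one_iff]
      exact (hn h).1

/-- Signed circuit elimination for circuit vectors. -/
lemma circ_elim (hc : c ∈ M.circ) (hc' : c' ∈ M.circ) {e : α} (he : c e ≠ 0)
    (he' : c e + c' e = 0) (hne : {x | c' x ≠ 0} ≠ {x | c x ≠ 0}) :
    ∃ d ∈ M.circ, d e = 0 ∧ ∀ x, d x ≠ 0 → d x = c x ∨ d x = c' x := by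
  rcases circ_val hc e with h | h | h
  · exact absurd h he
  · exact circ_elim_aux hc hc' h (by linarith) hne
  · obtain ⟨d, hd, hde, hdx⟩ := circ_elim_aux hc' hc (e := e) (by linarith) h hne.symm
    exact ⟨d, hd, hde, fun x hx => (hdx x hx).symm⟩

/-- The reduction modulo `2` of an integer vector. -/
noncomputable def mod2 {α : Type u} : (α →₀ ℤ) →+ (α →₀ ZMod 2) :=
  Finsupp.mapRange.addMonoidHom (Int.castAddHom (ZMod 2))

lemma mod2_apply (c : α →₀ ℤ) (x : α) : mod2 c x = (c x : ZMod 2) := rfl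

lemma mod2_eq_zero_iff (hc : c ∈ M.circ) (x : α) : mod2 c x = 0 ↔ c x = 0 := by
  rw [mod2_apply]
  rcases circ_val hc x with h | h | h <;> simp [h]

/-- A representation of the matroid annihilates the circuit vectors modulo `2`. -/
lemma linearCombination_mod2 {V : Type u} [AddCommGroup V] [Module (ZMod 2) V] {v : α → V}
    (hv : ∀ I ⊆ M.matroid.E, (M.matroid.Indep I ↔ LinearIndepOn (ZMod 2) v I))
    (hc : c ∈ M.circ) : Finsupp.linearCombination (ZMod 2) v (mod2 c) = 0 := by
  have hC := circ_isCircuit hc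
  have hdep : ¬ LinearIndepOn (ZMod 2) v {x | c x ≠ 0} := fun h =>
    hC.not_indep ((hv _ hC.subset_ground).2 h)
  rw [linearIndepOn_iff] at hdep
  push Not at hdep
  obtain ⟨l, hl, hl0, hlne⟩ := hdep
  have hls : (l.support : Set α) ⊆ {x | c x ≠ 0} := (Finsupp.mem_supported _ _).1 hl
  -- By minimality of the circuit a nontrivial dependence uses all of it, and over the two-element
  -- field a vector is determined by its support.
  have heq : (l.support : Set α) = {x | c x ≠ 0} := by
    refine hC.eq_of_not_indep_subset (fun h => hlne ?_) hls
    exact linearIndepOn_iff.1 ((hv _ (hls.trans hC.subset_ground)).1 h) l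
      ((Finsupp.mem_supported _ _).2 subset_rfl) hl0
  have : mod2 c = l := by
    ext x
    have hx : l x = 0 ↔ c x = 0 := by
      have : x ∈ (l.support : Set α) ↔ x ∈ {x | c x ≠ 0} := by rw [heq]
      simpa using this.not
    have h2 : ∀ a b : ZMod 2, (a = 0 ↔ b = 0) → a = b := by decide
    exact h2 _ _ ((mod2_eq_zero_iff hc x).trans hx.symm)
  rw [this, hl0]

/-- Circuits in the union of two fundamental circuits avoiding a common element: they are the
symmetric difference. -/
lemma mod2_eq_add (hM : M.IsBinary) (hB : M.matroid.IsBase B) {f f' : α} (hf : f ∉ B)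
    (hf' : f' ∉ B) (hff' : f ≠ f') (hc : c ∈ M.circ) (hc' : c' ∈ M.circ) (hd : d ∈ M.circ)
    (hcf : c f ≠ 0) (hcf' : c' f' ≠ 0) (hcB : ∀ x, c x ≠ 0 → x = f ∨ x ∈ B)
    (hcB' : ∀ x, c' x ≠ 0 → x = f' ∨ x ∈ B)
    (hdB : ∀ x, d x ≠ 0 → c x ≠ 0 ∨ c' x ≠ 0) {b : α} (hb : c b ≠ 0) (hb' : c' b ≠ 0)
    (hdb : d b = 0) : mod2 d = mod2 c + mod2 c' := by
  obtain ⟨V, _, _, v, hv⟩ := hM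
  have h2 : ∀ a : ZMod 2, a ≠ 0 → a = 1 := by decide
  have e1 : mod2 c f = 1 := h2 _ fun h => hcf ((mod2_eq_zero_iff hc f).1 h)
  have e2 : mod2 c' f' = 1 := h2 _ fun h => hcf' ((mod2_eq_zero_iff hc' f').1 h)
  have e3 : mod2 c f' = 0 := (mod2_eq_zero_iff hc f').2
    (by_contra fun h => (hcB f' h).elim (fun h => hff' h.symm) hf')
  have e4 : mod2 c' f = 0 := (mod2_eq_zero_iff hc' f).2
    (by_contra fun h => (hcB' f h).elim hff' hf)
  have e5 : mod2 c b = 1 := h2 _ fun h => hb ((mod2_eq_zero_iff hc b).1 h)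
  have e6 : mod2 c' b = 1 := h2 _ fun h => hb' ((mod2_eq_zero_iff hc' b).1 h)
  have e7 : mod2 d b = 0 := (mod2_eq_zero_iff hd b).2 hdb
  -- Subtracting the multiples of `c` and `c'` prescribed by the entries at `f` and `f'` leaves a
  -- dependence supported in the base `B`, which must be trivial.
  have key : mod2 d - mod2 d f • mod2 c - mod2 d f' • mod2 c' = 0 := by
    refine linearIndepOn_iff.1 ((hv B hB.subset_ground).1 hB.indep) _ ?_ ?_
    · rw [Finsupp.mem_supported]
      intro x hx
      by_contra hxB
      refine Finsupp.mem_support_iff.1 hx ?_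
      simp only [Finsupp.sub_apply, Finsupp.smul_apply, smul_eq_mul]
      by_cases hxf : x = f
      · rw [hxf, e1, e4]; ring
      by_cases hxf' : x = f'
      · rw [hxf', e2, e3]; ring
      have h1 : c x = 0 := by_contra fun h => (hcB x h).elim hxf hxB
      have h2 : c' x = 0 := by_contra fun h => (hcB' x h).elim hxf' hxB
      have h3 : d x = 0 := by_contra fun h => (hdB x h).elim (· h1) (· h2)
      rw [(mod2_eq_zero_iff hc x).2 h1, (mod2_eq_zero_iff hc' x).2 h2,
        (mod2_eq_zero_iff hd x).2 h3]
      ring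
    · rw [map_sub, map_sub, map_smul, map_smul, linearCombination_mod2 hv hc,
        linearCombination_mod2 hv hc', linearCombination_mod2 hv hd]
      simp
  -- The entry at `b` forces both coefficients to be equal; they are not 0 because `d` is nonempty.
  have hb0 : mod2 d f + mod2 d f' = 0 := by
    have := DFunLike.congr_fun key b
    simp only [Finsupp.sub_apply, Finsupp.smul_apply, smul_eq_mul, e5, e6, e7,
      Finsupp.zero_apply] at this
    linear_combination -this
  have h3 : ∀ a b : ZMod 2, a + b = 0 → (a = 0 ∧ b = 0) ∨ (a = 1 ∧ b = 1) := by decide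
  rcases h3 _ _ hb0 with ⟨h, h'⟩ | ⟨h, h'⟩
  · rw [h, h', zero_smul, zero_smul, sub_zero, sub_zero] at key
    obtain ⟨x, hx⟩ := (circ_isCircuit hd).nonempty
    exact absurd ((mod2_eq_zero_iff hd x).1 (by rw [key, Finsupp.zero_apply])) hx
  · rw [h, h', one_smul, one_smul, sub_sub, sub_eq_zero] at key
    exact key

/-- The sum of two fundamental circuit vectors that cancel at some element is a circuit vector. -/
lemma add_mem_circ (hM : M.IsBinary) (hB : M.matroid.IsBase B) {f f' : α} (hf : f ∉ B)
    (hf' : f' ∉ B) (hff' : f ≠ f') (hc : c ∈ M.circ) (hc' : c' ∈ M.circ)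
    (hcf : c f ≠ 0) (hcf' : c' f' ≠ 0) (hcB : ∀ x, c x ≠ 0 → x = f ∨ x ∈ B)
    (hcB' : ∀ x, c' x ≠ 0 → x = f' ∨ x ∈ B) {b : α} (hb : c b ≠ 0) (hb' : c b + c' b = 0) :
    c + c' ∈ M.circ := by
  have hcf0 : c' f = 0 := by_contra fun h => (hcB' f h).elim hff' hf
  have hcf0' : c f' = 0 := by_contra fun h => (hcB f' h).elim (fun h => hff' h.symm) hf'
  have hne : {x | c' x ≠ 0} ≠ {x | c x ≠ 0} := fun h => by
    have : f ∈ {x | c' x ≠ 0} := h ▸ hcf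
    exact this hcf0
  have key : ∀ c'' ∈ M.circ, (∀ x, c'' x = c' x ∨ c'' x = - c' x) → ∀ x, c x ≠ 0 →
      c x + c'' x = 0 → ∃ d ∈ M.circ, (∀ y, d y ≠ 0 → d y = c y ∨ d y = c'' y) ∧
        mod2 d = mod2 c + mod2 c' := by
    intro c'' hc'' hcc x hx hxs
    have h0 : ∀ y, c'' y = 0 ↔ c' y = 0 := fun y => by
      rcases hcc y with h | h <;> simp [h]
    have hne' : {x | c'' x ≠ 0} ≠ {x | c x ≠ 0} := by simpa only [ne_eq, h0] using hne
    obtain ⟨d, hd, hdx, hdy⟩ := circ_elim hc hc'' hx hxs hne'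
    have hm : mod2 c'' = mod2 c' := by
      ext y
      rw [mod2_apply, mod2_apply]
      rcases hcc y with h | h <;> simp [h]
    refine ⟨d, hd, hdy, ?_⟩
    rw [← hm]
    refine mod2_eq_add hM hB hf hf' hff' hc hc'' hd hcf (by rwa [ne_eq, h0]) hcB
      (fun y hy => hcB' y (by rwa [ne_eq, ← h0])) (fun y hy => ?_) hx
      (fun h => hx (by linarith)) hdx
    rcases hdy y hy with h | h
    · exact Or.inl (h ▸ hy)
    · exact Or.inr (h ▸ hy)
  obtain ⟨d, hd, hdy, hdm⟩ := key c' hc' (fun x => Or.inl rfl) b hb hb'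
  have hz : ∀ d ∈ M.circ, mod2 d = mod2 c + mod2 c' → ∀ y, d y = 0 ↔ (c y = 0 ↔ c' y = 0) := by
    intro d hd hdm y
    rw [← mod2_eq_zero_iff hd, ← mod2_eq_zero_iff hc, ← mod2_eq_zero_iff hc', hdm,
      Finsupp.add_apply]
    have : ∀ a b : ZMod 2, a + b = 0 ↔ (a = 0 ↔ b = 0) := by decide
    exact this _ _
  have hdf : d f = c f := by
    have h1 : d f ≠ 0 := by rw [ne_eq, hz d hd hdm]; tauto
    exact (hdy f h1).resolve_right fun h => h1 (h.trans hcf0)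
  have hdf' : d f' = c' f' := by
    have h1 : d f' ≠ 0 := by rw [ne_eq, hz d hd hdm]; tauto
    exact (hdy f' h1).resolve_left fun h => h1 (h.trans hcf0')
  -- If `c` and `c'` agreed at a common element, eliminating it between `c` and `-c'` would give a
  -- second circuit on the same symmetric difference. The two would agree at `f` and be opposite at
  -- `f'`, contradicting that the signing is unique up to a global sign.
  have hcancel : ∀ x, c x ≠ 0 → c' x ≠ 0 → c x + c' x = 0 := by
    intro x hx hx'
    by_contra hs
    have hxx : c x + (-c') x = 0 := by
      rw [Finsupp.neg_apply]
      rcases circ_val hc x with h | h | h <;> rcases circ_val hc' x with h' | h' | h' <;>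
        rw [h] at hx hs ⊢ <;> rw [h'] at hx' hs ⊢ <;> simp at hx hx' hs ⊢
    obtain ⟨d₂, hd₂, hdy₂, hdm₂⟩ := key (-c') (neg_mem_circ hc')
      (fun x => Or.inr (Finsupp.neg_apply _ _)) x hx hxx
    have h1 : d₂ f = c f := by
      have h1 : d₂ f ≠ 0 := by rw [ne_eq, hz d₂ hd₂ hdm₂]; tauto
      exact (hdy₂ f h1).resolve_right fun h => h1 (by rw [h, Finsupp.neg_apply, hcf0, neg_zero])
    have h2 : d₂ f' = -c' f' := by
      have h1 : d₂ f' ≠ 0 := by rw [ne_eq, hz d₂ hd₂ hdm₂]; tauto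
      exact (hdy₂ f' h1).resolve_left fun h => h1 (h.trans hcf0')
    have hsupp : {x | d₂ x ≠ 0} = {x | d x ≠ 0} := by
      ext y
      simp only [mem_ofPred_eq, ne_eq, hz d hd hdm, hz d₂ hd₂ hdm₂]
    rcases circ_unique hd hd₂ hsupp with h | h
    · rw [h, hdf'] at h2
      exact hcf' (by linarith)
    · rw [h, Finsupp.neg_apply, hdf] at h1
      exact hcf (by linarith)
  have : c + c' = d := by
    ext y
    rw [Finsupp.add_apply]
    have h0 := hz d hd hdm y
    by_cases h : c y = 0
    · by_cases h' : c' y = 0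
      · rw [h0.2 (by tauto), h, h', add_zero]
      · have h1 : d y ≠ 0 := by rw [ne_eq, h0]; tauto
        rw [h, zero_add]
        exact ((hdy y h1).resolve_left fun h'' => h1 (h''.trans h)).symm
    · by_cases h' : c' y = 0
      · have h1 : d y ≠ 0 := by rw [ne_eq, h0]; tauto
        rw [h', add_zero]
        exact ((hdy y h1).resolve_right fun h'' => h1 (h''.trans h')).symm
      · rw [hcancel y h h', h0.2 (by tauto)]
  exact this ▸ hd

/-- The circuit vectors with at most one element outside `B`. -/
def fund (M : FinitaryOrientedMatroid α) (B : Set α) : Set (α →₀ ℤ) :=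
  {c ∈ M.circ | ∃ f, ∀ x, c x ≠ 0 → x = f ∨ x ∈ B}

lemma exists_fund (hB : M.matroid.IsBase B) {x : α} (hx : x ∈ M.matroid.E) (hxB : x ∉ B) :
    ∃ c ∈ M.circ, c x ≠ 0 ∧ ∀ y, c y ≠ 0 → y = x ∨ y ∈ B := by
  obtain ⟨c, hc, hcC⟩ := exists_circ_of_isCircuit (hB.fundCircuit_isCircuit hx hxB)
  refine ⟨c, hc, ?_, fun y hy => ?_⟩
  · have := M.matroid.mem_fundCircuit x B
    rwa [← hcC] at this
  · have := M.matroid.fundCircuit_subset_insert x B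
    rw [← hcC] at this
    exact this hy

lemma fund_unique (hB : M.matroid.IsBase B) (hc : c ∈ M.circ) (hc' : c' ∈ M.circ) {f : α}
    (hcB : ∀ x, c x ≠ 0 → x = f ∨ x ∈ B) (hcB' : ∀ x, c' x ≠ 0 → x = f ∨ x ∈ B) :
    c' = c ∨ c' = -c := by
  refine circ_unique hc hc' ?_
  rw [(circ_isCircuit hc).eq_fundCircuit_of_subset hB.indep (e := f) hcB,
    (circ_isCircuit hc').eq_fundCircuit_of_subset hB.indep (e := f) hcB']

/-- A fundamental vector of the new base that is not one of the old base uses both `f` and an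
element `f₁` outside both bases. Adding to `c` the old fundamental vector of `f₁`, signed so as to
cancel at `b`, gives a circuit vector by `add_mem_circ`, and by uniqueness it is the given one up to
sign. -/
lemma fund_exchange_subset (hM : M.IsBinary) (hB : M.matroid.IsBase B) {f b : α} (hf : f ∉ B)
    (hB' : M.matroid.IsBase (insert f (B \ {b})))
    (hc : c ∈ M.circ) (hcf : c f ≠ 0) (hcB : ∀ x, c x ≠ 0 → x = f ∨ x ∈ B) (hb : c b ≠ 0) :
    M.fund (insert f (B \ {b})) ⊆ Submodule.span ℤ (M.fund B) := by
  rintro c₁ ⟨hc₁, f₁, hc₁B⟩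
  have hcfund : c ∈ Submodule.span ℤ (M.fund B) := Submodule.subset_span ⟨hc, f, hcB⟩
  by_cases hc₁f : c₁ f = 0
  · refine Submodule.subset_span ⟨hc₁, f₁, fun x hx => ?_⟩
    rcases hc₁B x hx with h | h | h
    · exact Or.inl h
    · exact absurd (h ▸ hc₁f) hx
    · exact Or.inr h.1
  by_cases hf₁ : f₁ ∈ B ∨ f₁ = f ∨ c₁ f₁ = 0
  · refine Submodule.subset_span ⟨hc₁, f, fun x hx => ?_⟩
    rcases hc₁B x hx with h | h | h
    · rcases hf₁ with h' | h' | h'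
      · exact Or.inr (h ▸ h')
      · exact Or.inl (h.trans h')
      · exact absurd (h ▸ h') hx
    · exact Or.inl h
    · exact Or.inr h.1
  push Not at hf₁
  obtain ⟨hf₁B, hf₁f, hc₁f₁⟩ := hf₁
  obtain ⟨c₂, hc₂, hc₂f₁, hc₂B⟩ :=
    exists_fund hB ((circ_isCircuit hc₁).subset_ground hc₁f₁) hf₁B
  have hc₂f : c₂ f = 0 := by_contra fun h => (hc₂B f h).elim (fun h => hf₁f h.symm) hf
  have hc₂b : c₂ b ≠ 0 := fun h0 => by
    have := fund_unique hB' hc₁ hc₂ hc₁B (fun x hx => (hc₂B x hx).imp id fun hxB =>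
      Or.inr ⟨hxB, fun hxb => hx (by rw [mem_singleton_iff.1 hxb, h0])⟩)
    rcases this with h | h
    · exact hc₁f (h ▸ hc₂f)
    · rw [h, Finsupp.neg_apply, neg_eq_zero] at hc₂f
      exact hc₁f hc₂f
  obtain ⟨c₃, hc₃, hc₃2, hc₃b⟩ : ∃ c₃ ∈ M.circ, (c₃ = c₂ ∨ c₃ = -c₂) ∧ c b + c₃ b = 0 := by
    by_cases h : c b + c₂ b = 0
    · exact ⟨c₂, hc₂, Or.inl rfl, h⟩
    · refine ⟨-c₂, neg_mem_circ hc₂, Or.inr rfl, ?_⟩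
      rw [Finsupp.neg_apply]
      rcases circ_val hc b with h1 | h1 | h1 <;> rcases circ_val hc₂ b with h2 | h2 | h2 <;>
        rw [h1] at h hb ⊢ <;> rw [h2] at h hc₂b ⊢ <;> simp at h hb hc₂b ⊢
  have h0 : ∀ y, c₃ y = 0 ↔ c₂ y = 0 := fun y => by
    rcases hc₃2 with h | h <;> simp [h]
  have hc₃B : ∀ x, c₃ x ≠ 0 → x = f₁ ∨ x ∈ B := fun x hx => hc₂B x (by rwa [ne_eq, ← h0])
  have hsum := add_mem_circ hM hB hf hf₁B hf₁f.symm hc hc₃ hcf (by rwa [ne_eq, h0]) hcB hc₃B hb hc₃b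
  have hmem : c + c₃ ∈ Submodule.span ℤ (M.fund B) :=
    add_mem hcfund (Submodule.subset_span ⟨hc₃, f₁, hc₃B⟩)
  have hsumB : ∀ x, (c + c₃) x ≠ 0 → x = f₁ ∨ x ∈ insert f (B \ {b}) := by
    intro x hx
    rw [Finsupp.add_apply] at hx
    by_cases hxb : x = b
    · exact absurd (hxb ▸ hc₃b) hx
    by_cases hcx : c x = 0
    · rw [hcx, zero_add] at hx
      exact (hc₃B x hx).imp id fun h => Or.inr ⟨h, hxb⟩
    · rcases hcB x hcx with h | h
      · exact Or.inr (Or.inl h)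
      · exact Or.inr (Or.inr ⟨h, hxb⟩)
  rcases fund_unique hB' hsum hc₁ hsumB hc₁B with h | h
  · exact h ▸ hmem
  · exact h ▸ neg_mem hmem

/-- The fundamental circuit vectors of a base span all circuit vectors. -/
lemma circ_subset_span_fund (hM : M.IsBinary) (hB : M.matroid.IsBase B) (hc : c ∈ M.circ) :
    c ∈ Submodule.span ℤ (M.fund B) := by
  classical
  induction hn : (c.support.filter (· ∉ B)).card using Nat.strong_induction_on generalizing B with
  | _ n ih =>
  by_cases hfund : c ∈ M.fund B
  · exact Submodule.subset_span hfund
  obtain ⟨f, hcf, hfB⟩ : ∃ f, c f ≠ 0 ∧ f ∉ B := by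
    by_contra! h
    exact (circ_isCircuit hc).not_indep (hB.indep.subset fun x hx => h x hx)
  have hfE := (circ_isCircuit hc).subset_ground hcf
  obtain ⟨d, hd, hdf, hdB⟩ := exists_fund hB hfE hfB
  -- Exchanging `b ∉ supp c` for `f ∈ supp c` leaves fewer elements of `c` outside the base. Such a
  -- `b` exists unless `c` is itself fundamental.
  obtain ⟨b, hdb, hcb⟩ : ∃ b, d b ≠ 0 ∧ c b = 0 := by
    by_contra! h
    have heq := (circ_isCircuit hd).eq_of_subset_isCircuit (circ_isCircuit hc) h
    exact hfund ⟨hc, f, fun x hx => hdB x (by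
      have : x ∈ {x | d x ≠ 0} := heq ▸ hx
      exact this)⟩
  have hbB : b ∈ B := (hdB b hdb).resolve_left fun h => hcf (h ▸ hcb)
  have hfcl : f ∉ M.matroid.closure (B \ {b}) := by
    intro hcl
    obtain ⟨C, hCB, hC, hfC⟩ := Matroid.exists_isCircuit_of_mem_closure hcl fun h => hfB h.1
    obtain ⟨c₁, hc₁, rfl⟩ := exists_circ_of_isCircuit hC
    have hc₁b : c₁ b = 0 := by_contra fun h =>
      (hCB h).elim (fun h => hfB (h ▸ hbB)) fun h => h.2 rfl
    rcases fund_unique hB hc₁ hd (f := f) (fun x hx => (hCB hx).imp id fun h => h.1) hdB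
      with h | h
    · exact hdb (h ▸ hc₁b)
    · exact hdb (by rw [h, Finsupp.neg_apply, hc₁b, neg_zero])
  have hB' : M.matroid.IsBase (insert f (B \ {b})) :=
    hB.exchange_base_of_notMem_closure hbB hfcl
  have hlt : (c.support.filter (· ∉ insert f (B \ {b}))).card < n := by
    rw [← hn]
    refine Finset.card_lt_card ⟨fun x hx => ?_, fun h => ?_⟩
    · rw [Finset.mem_filter] at hx ⊢
      refine ⟨hx.1, fun hxB => hx.2 (Or.inr ⟨hxB, fun hxb => ?_⟩)⟩
      rw [mem_singleton_iff.1 hxb] at hx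
      exact Finsupp.mem_support_iff.1 hx.1 hcb
    · have := h (Finset.mem_filter.2 ⟨Finsupp.mem_support_iff.2 hcf, hfB⟩)
      exact (Finset.mem_filter.1 this).2 (mem_insert _ _)
  exact Submodule.span_le.2 (fund_exchange_subset hM hB hfB hB' hd hdf hdB hdb)
    (ih _ hlt hB' (by congr))

/-- The values off `B` are dictated by orthogonality to the fundamental circuits of `B`;
orthogonality to all circuits then follows since these span. -/
lemma exists_cocirc (hM : M.IsBinary) (hB : M.matroid.IsBase B) {b : α} (hb : b ∈ B) :
    ∃ g : α → ℤ, g b = 1 ∧ (∀ x ∈ B, x ≠ b → g x = 0) ∧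
      (∀ x, x ∉ M.matroid.E → g x = 0) ∧ ∀ c ∈ M.circ, pairing g c = 0 := by
  classical
  set p : α → (α →₀ ℤ) → Prop := fun x c => c ∈ M.circ ∧ c x ≠ 0 ∧ ∀ y, c y ≠ 0 → y = x ∨ y ∈ B
    with hp
  -- The product is unchanged when `c` is replaced by `-c`, so the choice of fundamental vector is
  -- immaterial. The default 0 serves the elements outside the ground set.
  set g : α → ℤ := fun x => if x = b then 1 else if x ∈ B then 0 else
    if h : ∃ c, p x c then -(h.choose b * h.choose x) else 0 with hg
  have hgb : g b = 1 := if_pos rfl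
  have hgB : ∀ x ∈ B, x ≠ b → g x = 0 := fun x hx hxb => by simp [hg, hx, hxb]
  refine ⟨g, hgb, hgB, fun x hx => ?_, fun c hc => ?_⟩
  · have h1 : x ≠ b := fun h => hx (hB.subset_ground (h ▸ hb))
    have h2 : x ∉ B := fun h => hx (hB.subset_ground h)
    have h3 : ¬ ∃ c, p x c := fun ⟨c, hc, hcx, _⟩ => hx ((circ_isCircuit hc).subset_ground hcx)
    simp only [hg, if_neg h1, if_neg h2, dif_neg h3]
  · have hspan : Submodule.span ℤ (M.fund B) ≤ LinearMap.ker (pairing g) := by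
      refine Submodule.span_le.2 fun c hc => ?_
      obtain ⟨hc, f, hcB⟩ := hc
      have hfB : f ∉ B := fun h => (circ_isCircuit hc).not_indep (hB.indep.subset fun x hx =>
        (hcB x hx).elim (fun h' => h' ▸ h) id)
      have hcf : c f ≠ 0 := fun h => (circ_isCircuit hc).not_indep (hB.indep.subset fun x hx =>
        (hcB x hx).elim (fun h' => absurd (h' ▸ h) hx) id)
      have hbf : b ≠ f := fun h => hfB (h ▸ hb)
      have hex : ∃ c, p f c := ⟨c, hc, hcf, hcB⟩
      have hgf : g f = -(hex.choose b * hex.choose f) := by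
        simp only [hg, if_neg hbf.symm, if_neg hfB, dif_pos hex]
      obtain ⟨h1, h2, h3⟩ := hex.choose_spec
      have hgf' : g f = -(c b * c f) := by
        rw [hgf]
        rcases fund_unique hB hc h1 hcB h3 with h | h
        · rw [h]
        · rw [h, Finsupp.neg_apply, Finsupp.neg_apply]; ring
      change pairing g c = 0
      rw [pairing_eq_pair hbf, hgb, hgf']
      · rcases circ_val hc f with h | h | h
        · exact absurd h hcf
        all_goals rw [h]; ring
      · intro x hxb hxf
        by_cases hcx : c x = 0
        · exact Or.inl hcx
        · exact Or.inr (hgB x ((hcB x hcx).resolve_left hxf) hxb)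
    exact hspan (circ_subset_span_fund hM hB hc)

/-- The regular system of a binary finitary oriented matroid. -/
def toRegularSystem (M : FinitaryOrientedMatroid α) (hM : M.IsBinary) : RegularSystem α where
  M := M.matroid
  circ := M.circ
  neg_mem _ hc := neg_mem_circ hc
  val _ hc := circ_val hc
  isCircuit _ hc := circ_isCircuit hc
  exists_circ _ hC := exists_circ_of_isCircuit hC
  exists_cocirc _ hB _ hb := exists_cocirc hM hB hb

end FinitaryOrientedMatroid

/-! ### Signed cocircuits as vectors, and the equivalence -/

lemma mk_eq_of_pairwiseDisjoint {α : Type u} {𝒜 : Set (Set α)} (hdisj : 𝒜.PairwiseDisjoint id)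
    {P Q : Set α} (hP : P ⊆ ⋃₀ 𝒜) (hQ : Q ⊆ ⋃₀ 𝒜)
    (h : ∀ A ∈ 𝒜, #(A ∩ P : Set α) = #(A ∩ Q : Set α)) : #P = #Q := by
  have key : ∀ R ⊆ ⋃₀ 𝒜, #R = Cardinal.sum fun A : 𝒜 => #(A ∩ R : Set α) := by
    intro R hR
    rw [← mk_iUnion_eq_sum_mk]
    · congr 2
      rw [← iUnion_inter, ← sUnion_eq_iUnion, inter_eq_self_of_subset_right hR]
    · intro A B hAB
      exact (hdisj A.2 B.2 fun h => hAB (Subtype.ext h)).mono inter_subset_left inter_subset_left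
  rw [key P hP, key Q hQ]
  congr 1
  ext A
  exact h A A.2

namespace SignedSet

variable {α : Type u} {X Y : SignedSet α} {A : Set α}

lemma vec_eq_of_restrict_eq (h : X.restrict A = Y.restrict A) {x : α} (hx : x ∈ A) :
    X.vec x = Y.vec x := by
  have hp : x ∈ X.pos ↔ x ∈ Y.pos := by
    have : x ∈ X.pos ∩ A ↔ x ∈ Y.pos ∩ A := by
      change x ∈ (X.restrict A).pos ↔ x ∈ (Y.restrict A).pos
      rw [h]
    simpa [hx] using this
  have hn : x ∈ X.neg ↔ x ∈ Y.neg := by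
    have : x ∈ X.neg ∩ A ↔ x ∈ Y.neg ∩ A := by
      change x ∈ (X.restrict A).neg ↔ x ∈ (Y.restrict A).neg
      rw [h]
    simpa [hx] using this
  unfold vec
  split_ifs <;> tauto

lemma restrict_eq_of_vec_eq (h : ∀ x ∈ A, X.vec x = Y.vec x) :
    X.restrict A = Y.restrict A := by
  have hp : X.pos ∩ A = Y.pos ∩ A := by
    ext x
    refine and_congr_left fun hx => ?_
    rw [← vec_eq_one_iff, ← vec_eq_one_iff, h x hx]
  have hn : X.neg ∩ A = Y.neg ∩ A := by
    ext x
    refine and_congr_left fun hx => ?_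
    rw [← vec_eq_neg_one_iff, ← vec_eq_neg_one_iff, h x hx]
  exact SignedSet.ext hp hn

/-- The signed set of a function to the integers. -/
def ofFun (g : α → ℤ) : SignedSet α where
  pos := {x | 0 < g x}
  neg := {x | g x < 0}
  disjoint := disjoint_left.2 fun x (hx : 0 < g x) (hx' : g x < 0) => lt_asymm hx hx'

lemma ofFun_vec {g : α → ℤ} (hg : ∀ x, g x = 0 ∨ g x = 1 ∨ g x = -1) (x : α) :
    (ofFun g).vec x = g x := by
  rcases hg x with h | h | h <;> simp [vec, ofFun, h]

/-- Signed sets that are orthogonal as integer vectors are orthogonal. -/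
lemma orthogonal_of_pairing {C D : SignedSet α} {c : α →₀ ℤ} (hc : ∀ x, c x = C.vec x)
    (h : pairing D.vec c = 0) : C.Orthogonal D := by
  have aux : ∀ D : SignedSet α, pairing D.vec c = 0 → (C.support ∩ D.support).Nonempty →
      C.restrict (C.support ∩ D.support) ≠ D.restrict (C.support ∩ D.support) := by
    rintro D h ⟨e, heC, heD⟩ heq
    have hsame : ∀ x ∈ C.support ∩ D.support, c x = D.vec x := fun x hx =>
      (hc x).trans (vec_eq_of_restrict_eq heq hx)
    -- If the signs agreed on the whole intersection, the pairing would be a nonempty sum of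
    -- squares. The opposite case is the same argument for `-D`.
    refine (pairing_pos (e := e) (fun x => ?_) ?_).ne' h
    · by_cases hx : x ∈ C.support ∩ D.support
      · rw [hsame x hx]
        exact mul_self_nonneg _
      · rw [mem_inter_iff, not_and_or, ← vec_ne_zero_iff, ← vec_ne_zero_iff, not_not, not_not,
          ← hc] at hx
        rcases hx with hx | hx <;> simp [hx]
    · rw [hsame e ⟨heC, heD⟩]
      exact mul_self_pos.2 (vec_ne_zero_iff.2 heD)
  intro hne
  refine ⟨aux D h hne, ?_⟩
  have h' : pairing (-D).vec c = 0 := by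
    have : (-D).vec = -D.vec := funext fun x => vec_neg D x
    rw [this, pairing_neg_left, h, neg_zero]
  have := aux (-D) h'
  rw [support_neg] at this
  exact this hne

end SignedSet

/-- For two common elements with entries `±1`, being neither equal nor opposite means exactly that
the two products of signs cancel. Here weak orthogonality turns into integral orthogonality. -/
lemma eq_mul_of_signs {a b p q t : ℤ} (ha : a = 0 ∨ a = 1 ∨ a = -1) (hb : b = 0 ∨ b = 1 ∨ b = -1)
    (hp : p = 0 ∨ p = 1 ∨ p = -1) (hq : q = 0 ∨ q = 1 ∨ q = -1) (ha0 : a ≠ 0) (hb0 : b ≠ 0)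
    (hp0 : p ≠ 0) (hq0 : q ≠ 0) (h1 : ¬ (a = p ∧ b = q)) (h2 : ¬ (a = -p ∧ b = -q))
    (h : a + b * t = 0) : q = p * t := by
  rcases ha with rfl | rfl | rfl <;> rcases hb with rfl | rfl | rfl <;>
    rcases hp with rfl | rfl | rfl <;> rcases hq with rfl | rfl | rfl <;> omega

namespace FinitaryOrientedMatroid

variable {α : Type u} {M : FinitaryOrientedMatroid α}

/-- Signed cocircuits are orthogonal to all signed circuits as integer vectors. -/
lemma pairing_signedCocircuit (hM : M.IsBinary) {D : SignedSet α} (hD : D ∈ M.signedCocircuits)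
    {c : α →₀ ℤ} (hc : c ∈ M.circ) : pairing D.vec c = 0 := by
  obtain ⟨hK, horth⟩ := hD
  have hKdual := hK.isCircuit
  obtain ⟨b₀, hb₀⟩ := hK.nonempty
  have hco : M.matroid.Coindep (D.support \ {b₀}) := hKdual.sdiff_singleton_indep hb₀
  obtain ⟨B, hB, hBK⟩ := hco.exists_isBase_subset_compl
  have hBK' : ∀ x ∈ B, x ∈ D.support → x = b₀ := fun x hxB hxD => by
    by_contra h
    exact (hBK hxB).2 ⟨hxD, h⟩
  have hbB : b₀ ∈ B := by
    by_contra h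
    refine hKdual.not_indep (Matroid.coindep_iff_exists'.2 ⟨⟨B, hB, fun x hx =>
      ⟨hB.subset_ground hx, fun hxD => h (hBK' x hx hxD ▸ hx)⟩⟩, hK.subset_ground⟩)
  obtain ⟨g, hgb, hgB, hgE, hg⟩ := exists_cocirc hM hB hbB
  have hDb : D.vec b₀ ≠ 0 := SignedSet.vec_ne_zero_iff.2 hb₀
  -- The base `B` meets `D` only in `b₀`, so a fundamental circuit meets `D` at most in `b₀` and
  -- `x`, and never in exactly one element. The comparison of `D` with the dual vector `g` thus
  -- reduces to circuits with two common elements.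
  have key : ∀ x, D.vec x = D.vec b₀ * g x := by
    intro x
    by_cases hxE : x ∈ M.matroid.E
    swap
    · rw [hgE x hxE, mul_zero]
      by_contra h
      exact hxE (hK.subset_ground (SignedSet.vec_ne_zero_iff.1 h))
    by_cases hxB : x ∈ B
    · by_cases hxb : x = b₀
      · rw [hxb, hgb, mul_one]
      · rw [hgB x hxB hxb, mul_zero]
        by_contra h
        exact hxb (hBK' x hxB (SignedSet.vec_ne_zero_iff.1 h))
    obtain ⟨c, hc, hcx, hcB⟩ := exists_fund hB hxE hxB
    have hbx : b₀ ≠ x := fun h => hxB (h ▸ hbB)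
    have hpair := hg c hc
    rw [pairing_eq_pair hbx, hgb, mul_one] at hpair
    swap
    · intro y hyb hyx
      by_cases hcy : c y = 0
      · exact Or.inl hcy
      · exact Or.inr (hgB y ((hcB y hcy).resolve_left hyx) hyb)
    have hsub : ∀ y, c y ≠ 0 → y ∈ D.support → y = b₀ ∨ y = x := fun y hy hyD =>
      (hcB y hy).elim Or.inr fun h => Or.inl (hBK' y h hyD)
    by_cases hxK : x ∈ D.support
    · have hcb : c b₀ ≠ 0 := fun h0 => by
        refine (circ_isCircuit hc).inter_isCocircuit_ne_singleton hK (e := x) ?_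
        ext y
        refine ⟨fun hy => (hsub y hy.1 hy.2).resolve_left fun h => hy.1 (h ▸ h0), fun hy => ?_⟩
        rw [mem_singleton_iff.1 hy]
        exact ⟨hcx, hxK⟩
      obtain ⟨C, hC, hcC⟩ := id hc
      have hsuppC : ∀ y, y ∈ C.support ↔ c y ≠ 0 := fun y => by
        rw [hcC, SignedSet.vec_ne_zero_iff]
      obtain ⟨h1, h2⟩ := horth C hC ⟨x, (hsuppC x).2 hcx, hxK⟩
      have hDx : D.vec x ≠ 0 := SignedSet.vec_ne_zero_iff.2 hxK
      have hn1 : ¬ (c b₀ = D.vec b₀ ∧ c x = D.vec x) := fun ⟨e1, e2⟩ => by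
        refine h1 (SignedSet.restrict_eq_of_vec_eq fun y hy => ?_)
        rw [← hcC]
        rcases hsub y ((hsuppC y).1 hy.1) hy.2 with rfl | rfl <;> assumption
      have hn2 : ¬ (c b₀ = -D.vec b₀ ∧ c x = -D.vec x) := fun ⟨e1, e2⟩ => by
        refine h2 (SignedSet.restrict_eq_of_vec_eq (Y := -D) fun y hy => ?_)
        rw [← hcC, SignedSet.vec_neg]
        rcases hsub y ((hsuppC y).1 hy.1) hy.2 with rfl | rfl <;> assumption
      exact eq_mul_of_signs (circ_val hc b₀) (circ_val hc x) (D.vec_val b₀) (D.vec_val x)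
        hcb hcx hDb hDx hn1 hn2 hpair
    · have hcb : c b₀ = 0 := by
        by_contra hcb
        refine (circ_isCircuit hc).inter_isCocircuit_ne_singleton hK (e := b₀) ?_
        ext y
        refine ⟨fun hy => (hsub y hy.1 hy.2).resolve_right fun h => hxK (h ▸ hy.2), fun hy => ?_⟩
        rw [mem_singleton_iff.1 hy]
        exact ⟨hcb, hb₀⟩
      rw [hcb, zero_add] at hpair
      rw [(mul_eq_zero.1 hpair).resolve_left hcx, mul_zero]
      by_contra h
      exact hxK (SignedSet.vec_ne_zero_iff.1 h)
  have h1 := hg c hc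
  rw [pairing_eq_sum] at h1 ⊢
  rw [← mul_zero (D.vec b₀), ← h1, Finset.mul_sum]
  refine Finset.sum_congr rfl fun x _ => ?_
  rw [key x, mul_left_comm]

/-- The cocircuit vectors are signed cocircuits. -/
lemma ofFun_mem_signedCocircuits (hM : M.IsBinary) {g : α → ℤ}
    (hg : (M.toRegularSystem hM).IsCocirc g) : SignedSet.ofFun g ∈ M.signedCocircuits := by
  have hval := hg.val
  have hvec : (SignedSet.ofFun g).vec = g := funext (SignedSet.ofFun_vec hval)
  obtain ⟨hgE, hgc, B, hB, b, hb, hgb, hgB⟩ := hg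
  change M.matroid.IsBase B at hB
  refine ⟨?_, fun C hC => ?_⟩
  · have : (SignedSet.ofFun g).support = M.matroid.fundCocircuit b B := by
      rw [← SignedSet.support_vec, hvec]
      have hco := Matroid.fundCocircuit_isCocircuit hb hB
      ext x
      by_cases hxE : x ∈ M.matroid.E
      swap
      · exact ⟨fun h => absurd (hgE x hxE) h, fun h => absurd (hco.subset_ground h) hxE⟩
      by_cases hxB : x ∈ B
      · have h1 : x ∈ M.matroid.fundCocircuit b B ↔ x = b := by
          have := M.matroid.fundCocircuit_inter_eq hb
          have h2 : x ∈ M.matroid.fundCocircuit b B ∩ B ↔ x ∈ ({b} : Set α) := by rw [this]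
          simpa [hxB] using h2
        rw [h1]
        refine ⟨fun h => by_contra fun h' => h (hgB x hxB h'), fun h => ?_⟩
        rw [mem_ofPred_eq, h]
        omega
      -- Off `B`, membership of `x` in the fundamental cocircuit of `b` means that the fundamental
      -- circuit of `x` contains `b`, and pairing with that circuit shows this to be equivalent to
      -- `g x ≠ 0`.
      · rw [hB.mem_fundCocircuit_iff_mem_fundCircuit]
        obtain ⟨c, hc, hcx, hcB⟩ := exists_fund hB hxE hxB
        rw [← (circ_isCircuit hc).eq_fundCircuit_of_subset hB.indep (e := x) hcB]
        have hbx : b ≠ x := fun h => hxB (h ▸ hb)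
        have hpair := hgc c hc
        rw [pairing_eq_pair hbx] at hpair
        · rw [mem_ofPred_eq, mem_ofPred_eq, not_iff_not]
          have hgb0 : g b ≠ 0 := by omega
          constructor
          · intro h
            rw [h, mul_zero, add_zero] at hpair
            exact (mul_eq_zero.1 hpair).resolve_right hgb0
          · intro h
            rw [h, zero_mul, zero_add] at hpair
            exact (mul_eq_zero.1 hpair).resolve_left hcx
        · intro y hyb hyx
          by_cases hcy : c y = 0
          · exact Or.inl hcy
          · exact Or.inr (hgB y ((hcB y hcy).resolve_left hyx) hyb)
    rw [this]
    exact Matroid.fundCocircuit_isCocircuit hb hB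
  · obtain ⟨c, hc, h⟩ := exists_mem_circ hC
    exact SignedSet.orthogonal_of_pairing h (by rw [hvec]; exact hgc c hc)

lemma IsBalanced.toRegularSystem {hM : M.IsBinary} (h : M.IsBalanced) :
    (M.toRegularSystem hM).Balanced :=
  fun g hg => h (SignedSet.ofFun g) (ofFun_mem_signedCocircuits hM hg)

lemma IsBalanced.hasDirectedCircuitPartition (hM : M.IsBinary) (h : M.IsBalanced) :
    M.HasDirectedCircuitPartition := by
  obtain ⟨𝒜, h1, h2, h3⟩ := (h.toRegularSystem (hM := hM)).partition
  refine ⟨𝒜, h1, h2, fun A hA => ?_⟩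
  obtain ⟨c, ⟨C, hC, hcC⟩, hc0, rfl⟩ := h3 A hA
  refine ⟨C, hC, Or.inl ?_, ?_⟩
  · refine eq_empty_of_forall_notMem fun x hx => ?_
    have := hc0 x
    rw [hcC, SignedSet.vec_eq_neg_one_iff.2 hx] at this
    norm_num at this
  · simp only [hcC, SignedSet.support_vec]

lemma HasDirectedCircuitPartition.isBalanced (hM : M.IsBinary)
    (h : M.HasDirectedCircuitPartition) : M.IsBalanced := by
  obtain ⟨𝒜, hdisj, hcover, h𝒜⟩ := h
  intro D hD
  have hDE : D.support ⊆ ⋃₀ 𝒜 := hcover ▸ hD.1.subset_ground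
  have hp : {x | 0 < D.vec x} = D.pos := by
    ext x
    rw [mem_ofPred_eq, ← SignedSet.vec_eq_one_iff]
    have := D.vec_val x
    omega
  have hn : {x | D.vec x < 0} = D.neg := by
    ext x
    rw [mem_ofPred_eq, ← SignedSet.vec_eq_neg_one_iff]
    have := D.vec_val x
    omega
  refine mk_eq_of_pairwiseDisjoint hdisj (subset_union_left.trans hDE)
    (subset_union_right.trans hDE) fun A hA => ?_
  obtain ⟨C, hC, hdir, rfl⟩ := h𝒜 A hA
  obtain ⟨C', hC', hpos, hsupp⟩ : ∃ C' ∈ M.signedCircuits, C'.IsPositive ∧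
      C'.support = C.support := by
    rcases hdir with h | h
    · exact ⟨C, hC, h, rfl⟩
    · exact ⟨-C, neg_mem_signedCircuits hC, h, C.support_neg⟩
  obtain ⟨c, hc, hcC⟩ := exists_mem_circ hC'
  have hc01 : ∀ x, c x = 0 ∨ c x = 1 := fun x => by
    have h1 : c x ≠ -1 := by
      rw [hcC, ne_eq, SignedSet.vec_eq_neg_one_iff, hpos]
      exact notMem_empty x
    have := circ_val hc x
    omega
  have := mk_pos_eq_mk_neg_of_pairing hc01 D.vec_val (pairing_signedCocircuit hM hD hc)
  rw [hp, hn] at this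
  simpa only [hcC, SignedSet.support_vec, hsupp] using this

end FinitaryOrientedMatroid

theorem mainTheorem3 {α : Type u} (M : FinitaryOrientedMatroid α) (hM : M.IsBinary) :
    M.HasDirectedCircuitPartition ↔ M.IsBalanced :=
  ⟨fun h => h.isBalanced hM, fun h => h.hasDirectedCircuitPartition hM⟩
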